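/- A 2-ball multiplex state (hand capacity 2) is a sequence $\alpha = \langle \alpha_1, \alpha_2, \dots \rangle$ with $\alpha_i \in \{0,1,2\}$ and $\sum_{i \ge 1} \alpha_i = 2$; it is normal if all $\alpha_i \in \{0,1\}$. There is a transition $\alpha \to \beta$ if $\alpha_{i+1} \le \beta_i$ for all $i \ge 1$. A 2-ball multiplex prime pattern of period $n$ is a directed cycle $\alpha^{(1)} \to \alpha^{(2)} \to \cdots \to \alpha^{(n)} \to \alpha^{(1)}$ through $n$ distinct multiplex states, where cycles that differ by a rotation are identified. It is normal if all of its states are normal, and strict-multiplex otherwise. Let $M'(n,2)$ be the number of 2-ball multiplex prime patterns of period $n$, and let $(M' \setminus N')(n,2)$ be the number of those that are strict-multiplex. For $t \ge 1$ let \[ q_t = \frac12 \prod_{i=2}^{t} \frac{i-1}{2^i - i - 1}. \] Then the series $\gamma_{M'} = \sum_{t=1}^\infty (t+1) q_t$ and $\gamma_{M' \setminus N'} = \sum_{t=1}^\infty t\, q_t$ converge and, as $n \to \infty$, \[ M'(n,2) \sim \gamma_{M'}\, 2^n, \qquad (M' \setminus N')(n,2) \sim \gamma_{M' \setminus N'}\,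 2^n . \] -/

import Mathlib

noncomputable section

namespace Juggling

/-- A distribution of balls over future beats. The value at `i : ℕ` is the number of balls that land
`i + 1` beats from now, so the state `⟨α₁, α₂, …⟩` is the function `i ↦ α_{i+1}`; it has finite
support because there are finitely many balls. -/
abbrev State : Type := ℕ →₀ ℕ

/-- The total number of balls in a state. -/
def State.numBalls (α : State) : ℕ := α.sum fun _ m => m

/-- The normal `b`-ball states: every entry is `0` or `1` and the entries sum to `b`. -/
def normalStates (b : ℕ) : Set State :=
  {α | (∀ i, α i = 0 ∨ α i = 1) ∧ α.numBalls = b}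

/-- The multiplex `b`-ball states with hand capacity `k`: every entry lies in `{0, 1, …, k}` and the
entries sum to `b`. -/
def multiplexStates (b k : ℕ) : Set State :=
  {α | (∀ i, α i ≤ k) ∧ α.numBalls = b}

/-- The transition relation `α → β`: on each beat every ball comes down one position, and the balls
that land are thrown to arbitrary positions. In the notation `⟨α₁, α₂, …⟩` this says
`α_{i+1} ≤ β_i` for all `i ≥ 1`; conservation of the number of balls is enforced by the sets of
states in which patterns live. -/
def Transition (α β : State) : Prop := ∀ i, α (i + 1) ≤ β i

/-- The prime patterns of period `n` in the state graph with vertex set `S`: the directed cycles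
through `n` distinct states, considered up to rotation (Mathlib's `Cycle` is lists up to rotation,
and `Cycle.Chain` includes the transition from the last state back to the first). -/
def primePatterns (S : Set State) (n : ℕ) : Set (Cycle State) :=
  {ρ | ρ.length = n ∧ ρ.Nodup ∧ (∀ α ∈ ρ, α ∈ S) ∧ ρ.Chain Transition}

/-- The normal `b`-ball prime patterns of period `n`. -/
def normalPrimePatterns (b n : ℕ) : Set (Cycle State) :=
  primePatterns (normalStates b) n

/-- The `b`-ball multiplex prime patterns of period `n` with hand capacity `k`. -/
def multiplexPrimePatterns (b n k : ℕ) : Set (Cycle State) :=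
  primePatterns (multiplexStates b k) n

/-- The strict-multiplex `2`-ball prime patterns of period `n`: those that are not normal. -/
def strictMultiplexPrimePatterns (n : ℕ) : Set (Cycle State) :=
  multiplexPrimePatterns 2 n 2 \ normalPrimePatterns 2 n

/-- The number of `2`-ball multiplex prime patterns of period `n` (capacity `2`). -/
def multiplexCount (n : ℕ) : ℕ := (multiplexPrimePatterns 2 n 2).ncard

/-- The number of strict-multiplex `2`-ball prime patterns of period `n`. -/
def strictMultiplexCount (n : ℕ) : ℕ := (strictMultiplexPrimePatterns n).ncard

/-- `q_t = (1/2) ∏_{i=2}^t (i - 1) / (2^i - i - 1)`, for `t ≥ 1`. -/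
def q (t : ℕ+) : ℝ :=
  1 / 2 * ∏ i ∈ Finset.Icc 2 (t : ℕ), ((i : ℝ) - 1) / (2 ^ i - (i : ℝ) - 1)

end Juggling

end

/-! Write a two-ball state as `(a, d)`: the next ball lands at position `a`, the other `d` positions
later. If `a > 0`, the next state is forced to be `(a - 1, d)`, so a pattern splits into blocks `(m,
d), …, (0, d)` of `m + 1` states. Every block passes through `(0, d)`, hence a pattern is prime
exactly when its blocks have distinct differences `d`.

From `(0, d)` with `d > 0`, the ball still in the air is at `d - 1` and becomes either the upper or
the lower ball of the next state `(m, d')`. If it is the upper one, then `m + 1 = d - d'`; if it is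
the lower one, then `m + 1 = d` and `d'` is arbitrary. Grouping the differences into maximal runs
with the same ball in the air gives decreasing sequences, i.e. finite sets of positive integers, and
the costs within a run telescope to its maximum. A prime path is thus a list of disjoint runs, with
length the sum of the maxima (`Encodes`).

A strict-multiplex pattern passes through `(0, 0)`. Cut there; the throw out of `(0, 0)` is free and
absorbs any slack, so these patterns correspond to lists of runs of total weight less than `n`. A
normal pattern never has `d = 0`. Cut it at its largest difference; it becomes a list of runs of
weight exactly `n` whose first run has the largest maximum. The maxima are distinct, so by symmetry
such lists are a fraction `1 / t` of all lists of `t` runs.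

Let `a_t(n)` be the number of `t`-tuples of runs of weight `n`. Deleting the element `1` and
shifting down gives `a_t(n + t) = (t + 1) a_t(n) + t a_{t-1}(n)` (`tupleCount_succ`). Hence `a_t(n)
/ 2 ^ n` tends to `t q_t`, which for `t ≥ 1` is also an upper bound, so dominated convergence allows
summation over `t`. Normal patterns contribute `∑ q_t`; strict ones contribute `∑ t q_t`, since
summing over weights below `n` preserves an asymptotic `c 2 ^ n`. -/

noncomputable section

namespace Juggling

open Filter Topology

/-! ### Tuples of runs and their recursion -/

/-- Translation of a finite set of natural numbers by `1`. -/
def shift (A : Finset ℕ) : Finset ℕ := A.image (· + 1)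

/-- The inverse of `shift` on the part of a set above `1`. -/
def unshift (B : Finset ℕ) : Finset ℕ := (B.erase 1).image (· - 1)

theorem mem_shift {A : Finset ℕ} {x : ℕ} : x ∈ shift A ↔ ∃ y ∈ A, y + 1 = x := by
  simp [shift]

theorem succ_mem_shift {A : Finset ℕ} {x : ℕ} : x + 1 ∈ shift A ↔ x ∈ A := by
  simp [shift]

theorem zero_notMem_shift (A : Finset ℕ) : 0 ∉ shift A := by simp [shift]

theorem shift_injective : Function.Injective shift :=
  Finset.image_injective (add_left_injective 1)

theorem one_notMem_shift {A : Finset ℕ} (h : 0 ∉ A) : 1 ∉ shift A := by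
  simpa [shift] using h

theorem shift_unshift {B : Finset ℕ} (h : 0 ∉ B) : shift (unshift B) = B.erase 1 := by
  ext x
  simp only [shift, unshift, Finset.mem_image, Finset.mem_erase]
  constructor
  · rintro ⟨_, ⟨y, ⟨hy, hyB⟩, rfl⟩, rfl⟩
    have : y ≠ 0 := fun h0 => h (h0 ▸ hyB)
    have e : y - 1 + 1 = y := by omega
    rw [e]
    exact ⟨hy, hyB⟩
  · rintro ⟨hx, hxB⟩
    have : x ≠ 0 := fun h0 => h (h0 ▸ hxB)
    exact ⟨x - 1, ⟨x, ⟨hx, hxB⟩, rfl⟩, by omega⟩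

theorem zero_notMem_unshift {B : Finset ℕ} (h : 0 ∉ B) : 0 ∉ unshift B := by
  rw [← succ_mem_shift, shift_unshift h]
  simp

theorem sup_shift {A : Finset ℕ} (h : A.Nonempty) : (shift A).sup id = A.sup id + 1 := by
  apply le_antisymm
  · refine Finset.sup_le fun x hx => ?_
    obtain ⟨y, hy, rfl⟩ := mem_shift.1 hx
    exact Nat.succ_le_succ (Finset.le_sup (f := id) hy)
  · obtain ⟨y, hy, e⟩ := Finset.exists_mem_eq_sup A h id
    rw [e]
    exact Finset.le_sup (f := id) (succ_mem_shift.2 hy)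

theorem shift_nonempty {A : Finset ℕ} : (shift A).Nonempty ↔ A.Nonempty := by
  simp [shift]

/-- The `t`-tuples of pairwise disjoint nonempty finite sets of positive integers whose maxima add
up to `n`. -/
def runTuples (t n : ℕ) : Set (Fin t → Finset ℕ) :=
  {A | (∀ i, (A i).Nonempty) ∧ (∀ i, 0 ∉ A i) ∧ (Pairwise fun i j => Disjoint (A i) (A j)) ∧
    ∑ i, (A i).sup id = n}

/-- Shift all sets of a tuple and possibly put the new element `1` in one of them. -/
def growTuple {t : ℕ} (p : Option (Fin t) × (Fin t → Finset ℕ)) (i : Fin t) : Finset ℕ :=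
  if p.1 = some i then insert 1 (shift (p.2 i)) else shift (p.2 i)

/-- Shift all sets of a tuple and insert the new set `{1}`. -/
def newTuple {t : ℕ} (p : Fin (t + 1) × (Fin t → Finset ℕ)) : Fin (t + 1) → Finset ℕ :=
  p.1.insertNth {1} fun j => shift (p.2 j)

theorem mem_growTuple {t : ℕ} {p : Option (Fin t) × (Fin t → Finset ℕ)} {i : Fin t} {x : ℕ} :
    x ∈ growTuple p i ↔ (x = 1 ∧ p.1 = some i) ∨ x ∈ shift (p.2 i) := by
  unfold growTuple
  split_ifs with h <;> simp [h]

theorem sup_growTuple {t : ℕ} {p : Option (Fin t) × (Fin t → Finset ℕ)} {i : Fin t}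
    (h : (p.2 i).Nonempty) : (growTuple p i).sup id = (p.2 i).sup id + 1 := by
  unfold growTuple
  split_ifs
  · rw [Finset.sup_insert, sup_shift h]
    simp
  · exact sup_shift h

theorem growTuple_mem {t n : ℕ} {p : Option (Fin t) × (Fin t → Finset ℕ)}
    (h : p.2 ∈ runTuples t n) : growTuple p ∈ runTuples t (n + t) := by
  obtain ⟨h1, h2, h3, h4⟩ := h
  refine ⟨fun i => ?_, fun i => ?_, fun i j hij => ?_, ?_⟩
  · obtain ⟨x, hx⟩ := h1 i
    exact ⟨x + 1, mem_growTuple.2 (Or.inr (succ_mem_shift.2 hx))⟩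
  · simp [mem_growTuple, zero_notMem_shift]
  · change Disjoint _ _
    rw [Finset.disjoint_left]
    intro x hx hx'
    rw [mem_growTuple] at hx hx'
    rcases hx with ⟨rfl, hx⟩ | hx
    · rcases hx' with ⟨_, hx'⟩ | hx'
      · exact hij (Option.some_injective _ (hx.symm.trans hx'))
      · exact one_notMem_shift (h2 j) hx'
    · rcases hx' with ⟨rfl, hx'⟩ | hx'
      · exact one_notMem_shift (h2 i) hx
      · obtain ⟨y, hy, rfl⟩ := mem_shift.1 hx
        exact Finset.disjoint_left.1 (h3 hij) hy (succ_mem_shift.1 hx')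
  · simp_rw [sup_growTuple (h1 _)]
    rw [Finset.sum_add_distrib, h4]
    simp

theorem newTuple_mem {t n : ℕ} {p : Fin (t + 1) × (Fin t → Finset ℕ)}
    (h : p.2 ∈ runTuples t n) : newTuple p ∈ runTuples (t + 1) (n + (t + 1)) := by
  obtain ⟨h1, h2, h3, h4⟩ := h
  have d1 : ∀ j, Disjoint {1} (shift (p.2 j)) := fun j => by
    simpa using one_notMem_shift (h2 j)
  refine ⟨?_, ?_, ?_, ?_⟩
  · rw [Fin.forall_iff_succAbove p.1]
    simp [newTuple, shift_nonempty, h1]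
  · rw [Fin.forall_iff_succAbove p.1]
    simp [newTuple, zero_notMem_shift]
  · intro i j hij
    rcases Fin.eq_self_or_eq_succAbove p.1 i with rfl | ⟨i, rfl⟩
    · obtain ⟨j, rfl⟩ := Fin.exists_succAbove_eq hij.symm
      simpa [newTuple] using one_notMem_shift (h2 j)
    · rcases Fin.eq_self_or_eq_succAbove p.1 j with rfl | ⟨j, rfl⟩
      · simpa [newTuple] using one_notMem_shift (h2 i)
      · simp only [newTuple, Fin.insertNth_apply_succAbove]
        rw [shift, shift, Finset.disjoint_image (add_left_injective 1)]
        exact h3 fun e => hij (by rw [e])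
  · rw [Fin.sum_univ_succAbove _ p.1]
    simp only [newTuple, Fin.insertNth_apply_same, Fin.insertNth_apply_succAbove,
      sup_shift (h1 _)]
    rw [Finset.sum_add_distrib, h4]
    simp
    omega

theorem injOn_growTuple (t n : ℕ) :
    Set.InjOn (growTuple (t := t)) (Set.univ ×ˢ runTuples t n) := by
  rintro ⟨o, A⟩ ⟨-, hA⟩ ⟨o', A'⟩ ⟨-, hA'⟩ h
  have key : ∀ i x, x ∈ growTuple (o, A) i ↔ x ∈ growTuple (o', A') i := by simp [h]
  simp only [mem_growTuple] at key
  have e : A = A' := by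
    funext i
    ext x
    rcases Nat.eq_zero_or_pos x with rfl | hx
    · exact iff_of_false (hA.2.1 i) (hA'.2.1 i)
    · have := key i (x + 1)
      simpa [succ_mem_shift, hx.ne'] using this
  have e' : o = o' := by
    ext i
    have := key i 1
    simpa [one_notMem_shift (hA.2.1 i), one_notMem_shift (hA'.2.1 i)] using this
  rw [e, e']

theorem injOn_newTuple (t n : ℕ) :
    Set.InjOn (newTuple (t := t)) (Set.univ ×ˢ runTuples t n) := by
  rintro ⟨i, A⟩ ⟨-, hA⟩ ⟨i', A'⟩ ⟨-, hA'⟩ h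
  have e : i = i' := by
    by_contra hne
    obtain ⟨j, rfl⟩ := Fin.exists_succAbove_eq hne
    have := congrFun h (i'.succAbove j)
    simp only [newTuple, Fin.insertNth_apply_same, Fin.insertNth_apply_succAbove] at this
    exact one_notMem_shift (hA'.2.1 j) (this ▸ Finset.mem_singleton_self 1)
  subst e
  have : A = A' := by
    funext j
    have := congrFun h (i.succAbove j)
    simp only [newTuple, Fin.insertNth_apply_succAbove] at this
    exact shift_injective this
  rw [this]

/-- Delete the element `1` and shift down. If no set is `{1}`, all `t + 1` sets survive and each
maximum drops by one. If some set is `{1}`, it vanishes and the `t` others drop by one. Either way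
the weight falls by `t + 1`. -/
theorem runTuples_succ_eq_union (t n : ℕ) :
    runTuples (t + 1) (n + (t + 1)) =
      growTuple '' (Set.univ ×ˢ runTuples (t + 1) n) ∪
        newTuple '' (Set.univ ×ˢ runTuples t n) := by
  apply Set.Subset.antisymm
  · rintro B ⟨h1, h2, h3, h4⟩
    by_cases hB : ∃ i, B i = {1}
    · obtain ⟨i, hi⟩ := hB
      have h1' : ∀ j, 1 ∉ B (i.succAbove j) := fun j hj =>
        Finset.disjoint_left.1 (h3 (Fin.succAbove_ne i j)) hj (by simp [hi])
      have e : ∀ j, shift (unshift (B (i.succAbove j))) = B (i.succAbove j) := fun j => by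
        rw [shift_unshift (h2 _), Finset.erase_eq_of_notMem (h1' j)]
      have hne : ∀ j, (unshift (B (i.succAbove j))).Nonempty := fun j => by
        rw [← shift_nonempty, e]
        exact h1 _
      refine Or.inr ⟨(i, fun j => unshift (B (i.succAbove j))),
        ⟨trivial, hne, fun j => zero_notMem_unshift (h2 _), fun j k hjk => ?_, ?_⟩, ?_⟩
      · refine ( Finset.disjoint_image (add_left_injective 1)).1 ?_
        change Disjoint (shift _) (shift _)
        simp only [e]
        exact h3 (by simpa using hjk)
      · rw [Fin.sum_univ_succAbove _ i] at h4
        have hs : ∀ j, (B (i.succAbove j)).sup id = (unshift (B (i.succAbove j))).sup id + 1 :=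
          fun j => by rw [← sup_shift (hne j), e]
        rw [hi, Finset.sum_congr rfl fun j _ => hs j, Finset.sum_add_distrib,
          Finset.sup_singleton] at h4
        simp only [Finset.sum_const, Finset.card_univ, Fintype.card_fin, smul_eq_mul, id] at h4
        change ∑ j, (unshift (B (i.succAbove j))).sup id = n
        omega
      · funext k
        rcases Fin.eq_self_or_eq_succAbove i k with rfl | ⟨k, rfl⟩
        · simp [newTuple, hi]
        · simp [newTuple, e]
    · push Not at hB
      have e : ∀ j, shift (unshift (B j)) = (B j).erase 1 := fun j => shift_unshift (h2 _)
      have hne : ∀ j, (unshift (B j)).Nonempty := fun j => by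
        rw [← shift_nonempty, e, Finset.nonempty_iff_ne_empty, Ne, Finset.erase_eq_empty_iff]
        exact not_or.2 ⟨(h1 j).ne_empty, hB j⟩
      -- By disjointness at most one set contains `1`; `o` records which one, if any.
      have ho : ∃ o : Option (Fin (t + 1)), ∀ i, 1 ∈ B i ↔ o = some i := by
        by_cases h : ∃ i, 1 ∈ B i
        · obtain ⟨i, hi⟩ := h
          refine ⟨some i, fun j => ⟨fun hj => ?_, fun hj => ?_⟩⟩
          · by_contra hij
            exact Finset.disjoint_left.1 (h3 fun e => hij (by rw [e])) hi hj
          · rwa [← Option.some_injective _ hj]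
        · push Not at h
          exact ⟨none, fun j => iff_of_false (h j) (by simp)⟩
      obtain ⟨o, ho⟩ := ho
      have eB : growTuple (o, fun j => unshift (B j)) = B := by
        funext i
        ext x
        rw [mem_growTuple]
        simp only [e, ← ho, Finset.mem_erase]
        by_cases hx : x = 1
        · simp [hx]
        · simp [hx]
      refine Or.inl ⟨(o, fun j => unshift (B j)),
        ⟨trivial, hne, fun j => zero_notMem_unshift (h2 _), fun j k hjk => ?_, ?_⟩, eB⟩
      · refine ( Finset.disjoint_image (add_left_injective 1)).1 ?_
        change Disjoint (shift _) (shift _)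
        simp only [e]
        exact (h3 hjk).mono (Finset.erase_subset _ _) (Finset.erase_subset _ _)
      · rw [← eB] at h4
        simp_rw [sup_growTuple (p := (o, fun j => unshift (B j))) (hne _)] at h4
        rw [Finset.sum_add_distrib] at h4
        simpa using h4
  · rintro _ (⟨p, ⟨-, hp⟩, rfl⟩ | ⟨p, ⟨-, hp⟩, rfl⟩)
    · exact growTuple_mem hp
    · exact newTuple_mem hp

theorem runTuples_of_lt {t n : ℕ} (h : n < t) : runTuples t n = ∅ := by
  rw [Set.eq_empty_iff_forall_notMem]
  rintro A ⟨h1, h2, -, h4⟩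
  have : ∑ _i : Fin t, 1 ≤ ∑ i, (A i).sup id := by
    refine Finset.sum_le_sum fun i _ => ?_
    obtain ⟨x, hx⟩ := h1 i
    have : x ≠ 0 := fun h0 => h2 i (h0 ▸ hx)
    exact (Nat.one_le_iff_ne_zero.2 this).trans (Finset.le_sup (f := id) hx)
  rw [h4] at this
  simp at this
  omega

theorem finite_runTuples (t n : ℕ) : (runTuples t n).Finite := by
  induction n using Nat.strong_induction_on generalizing t with
  | _ n ih =>
    rcases t with _ | t
    · exact Set.toFinite _
    · rcases lt_or_ge n (t + 1) with h | h
      · rw [runTuples_of_lt h]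
        exact Set.finite_empty
      · obtain ⟨m, rfl⟩ := Nat.exists_eq_add_of_le' h
        rw [runTuples_succ_eq_union]
        exact ((Set.finite_univ.prod (ih m (by omega) _)).image _).union
          ((Set.finite_univ.prod (ih m (by omega) _)).image _)

/-- The number of `t`-tuples of runs of total weight `n`. -/
def tupleCount (t n : ℕ) : ℕ := (runTuples t n).ncard

theorem tupleCount_of_lt {t n : ℕ} (h : n < t) : tupleCount t n = 0 := by
  rw [tupleCount, runTuples_of_lt h, Set.ncard_empty]

theorem tupleCount_zero_zero : tupleCount 0 0 = 1 := by
  rw [tupleCount, Set.ncard_eq_one]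
  refine ⟨Fin.elim0, Set.eq_singleton_iff_unique_mem.2 ⟨?_, fun A _ => Subsingleton.elim _ _⟩⟩
  exact ⟨fun i => i.elim0, fun i => i.elim0, fun i => i.elim0, by simp⟩

theorem tupleCount_zero_succ (n : ℕ) : tupleCount 0 (n + 1) = 0 := by
  rw [tupleCount, Set.ncard_eq_zero (finite_runTuples _ _), Set.eq_empty_iff_forall_notMem]
  rintro A ⟨-, -, -, h⟩
  simp at h

theorem tupleCount_succ (t n : ℕ) :
    tupleCount (t + 1) (n + (t + 1)) =
      (t + 2) * tupleCount (t + 1) n + (t + 1) * tupleCount t n := by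
  rw [tupleCount, runTuples_succ_eq_union, Set.ncard_union_eq ?_
      ((Set.finite_univ.prod (finite_runTuples _ _)).image _)
      ((Set.finite_univ.prod (finite_runTuples _ _)).image _),
    (injOn_growTuple _ _).ncard_image, (injOn_newTuple _ _).ncard_image, Set.ncard_prod,
    Set.ncard_prod, Set.ncard_univ, Set.ncard_univ]
  · simp [tupleCount]
  · rw [Set.disjoint_left]
    rintro _ ⟨p, ⟨-, hp⟩, rfl⟩ ⟨p', ⟨-, hp'⟩, h⟩
    obtain ⟨x, hx⟩ := hp.1 p'.1
    have h' := congrFun h p'.1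
    simp only [newTuple, Fin.insertNth_apply_same] at h'
    have : x + 1 ∈ growTuple p p'.1 := mem_growTuple.2 (Or.inr (succ_mem_shift.2 hx))
    rw [← h'] at this
    simp at this
    exact hp.2.1 p'.1 (this ▸ hx)

/-! ### Tuples with the largest run in front -/

/-- The tuples of runs in which the run with the largest maximum comes first. -/
def leadingTuples (t n : ℕ) : Set (Fin (t + 1) → Finset ℕ) :=
  {A ∈ runTuples (t + 1) n | ∀ i, (A i).sup id ≤ (A 0).sup id}

theorem comp_swap_mem_runTuples {t n : ℕ} {A : Fin t → Finset ℕ} (h : A ∈ runTuples t n)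
    (σ : Equiv.Perm (Fin t)) : A ∘ σ ∈ runTuples t n := by
  obtain ⟨h1, h2, h3, h4⟩ := h
  refine ⟨fun i => h1 _, fun i => h2 _, fun i j hij => h3 fun e => hij (σ.injective e), ?_⟩
  rw [← h4]
  exact Equiv.sum_comp σ fun i => (A i).sup id

theorem eq_of_sup_eq_sup {t n : ℕ} {A : Fin t → Finset ℕ} (h : A ∈ runTuples t n) {i j : Fin t}
    (e : (A i).sup id = (A j).sup id) : i = j := by
  by_contra hij
  obtain ⟨x, hx, ex⟩ := Finset.exists_mem_eq_sup _ (h.1 i) id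
  obtain ⟨y, hy, ey⟩ := Finset.exists_mem_eq_sup _ (h.1 j) id
  have : x = y := by simpa using ex.symm.trans (e.trans ey)
  exact Finset.disjoint_left.1 (h.2.2.1 hij) hx (this ▸ hy)

/-- Disjoint runs have distinct maxima, so the largest run has a well-defined place `i`. Swapping
places `0` and `i` moves it to the front and is reversible once `i` is known. -/
theorem succ_mul_ncard_leadingTuples (t n : ℕ) :
    (t + 1) * (leadingTuples t n).ncard = tupleCount (t + 1) n := by
  have h : Set.BijOn (fun p : Fin (t + 1) × (Fin (t + 1) → Finset ℕ) => p.2 ∘ Equiv.swap 0 p.1)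
      (Set.univ ×ˢ leadingTuples t n) (runTuples (t + 1) n) := by
    refine ⟨?_, ?_, ?_⟩
    · rintro ⟨i, A⟩ ⟨-, hA⟩
      exact comp_swap_mem_runTuples hA.1 _
    · rintro ⟨i, A⟩ ⟨-, hA⟩ ⟨j, A'⟩ ⟨-, hA'⟩ e
      simp only at e hA hA'
      have m1 := hA.2 (Equiv.swap 0 i j)
      have m2 := hA'.2 (Equiv.swap 0 j i)
      have e1 := congrFun e i
      have e2 := congrFun e j
      simp only [Function.comp_apply, Equiv.swap_apply_right] at e1 e2
      rw [e2] at m1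
      rw [← e1] at m2
      -- The leading maxima of `A` and `A'` bound each other, so they agree, and equal maxima force
      -- equal indices.
      have : Equiv.swap 0 i j = 0 :=
        eq_of_sup_eq_sup hA.1 (le_antisymm (e2 ▸ m1) (by rw [e2]; exact m2))
      have hij : i = j := by
        rw [Equiv.swap_apply_eq_iff] at this
        simpa using this.symm
      subst hij
      have : A = A' := by
        funext k
        have := congrFun e (Equiv.swap 0 i k)
        simpa using this
      rw [this]
    · intro B hB
      obtain ⟨i, -, hi⟩ := Finset.exists_max_image Finset.univ (fun i => (B i).sup id)
        Finset.univ_nonempty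
      refine ⟨(i, B ∘ Equiv.swap 0 i), ⟨trivial, comp_swap_mem_runTuples hB _, fun j => ?_⟩, ?_⟩
      · simpa using hi (Equiv.swap 0 i j) (Finset.mem_univ _)
      · funext k
        simp
  have := h.ncard_eq
  rw [Set.ncard_prod, Set.ncard_univ] at this
  simpa [tupleCount] using this

/-! ### Linear recursions and the densities of tuples of runs -/

/-- A bounded sequence with `x (n + k) = r * x n + y n`, where `0 ≤ r < 1` and `y` converges,
converges to the fixed point of the limiting recursion. -/
theorem tendsto_of_recursion {x y : ℕ → ℝ} {k : ℕ} {r b l C : ℝ} (hr0 : 0 ≤ r) (hr1 : r < 1)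
    (hx : ∀ n, x (n + k) = r * x n + y n) (hy : Tendsto y atTop (𝓝 b)) (hl : l = r * l + b)
    (hC : ∀ n, |x n| ≤ C) : Tendsto x atTop (𝓝 l) := by
  rw [Metric.tendsto_atTop]
  intro ε hε
  -- With this tolerance on `y`, the error bound `ε / 2` is fixed by one step of the recursion.
  have hδ : 0 < (1 - r) * (ε / 2) := mul_pos (by linarith) (by linarith)
  obtain ⟨N, hN⟩ := Metric.tendsto_atTop.1 hy _ hδ
  have hB : ∀ n, |x n - l| ≤ C + |l| := fun n => (abs_sub _ _).trans (by linarith [hC n])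
  have key : ∀ j n, N + j * k ≤ n → |x n - l| ≤ r ^ j * (C + |l|) + ε / 2 := by
    intro j
    induction j with
    | zero => intro n _; linarith [hB n]
    | succ j ih =>
      intro n hn
      rw [Nat.succ_mul] at hn
      obtain ⟨m, rfl⟩ : ∃ m, n = m + k := ⟨n - k, by omega⟩
      have h1 := ih m (by omega)
      have hyN := hN m (by nlinarith [Nat.zero_le (j * k)])
      rw [Real.dist_eq] at hyN
      have e : x (m + k) - l = r * (x m - l) + (y m - b) := by rw [hx]; linarith
      rw [e]
      calc |r * (x m - l) + (y m - b)| ≤ r * |x m - l| + |y m - b| :=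
            (abs_add_le _ _).trans (by rw [abs_mul, abs_of_nonneg hr0])
        _ ≤ r * (r ^ j * (C + |l|) + ε / 2) + (1 - r) * (ε / 2) := by gcongr
        _ = r ^ (j + 1) * (C + |l|) + ε / 2 := by ring
  have hlim : Tendsto (fun j => r ^ j * (C + |l|)) atTop (𝓝 0) := by
    simpa using (tendsto_pow_atTop_nhds_zero_of_lt_one hr0 hr1).mul_const (C + |l|)
  obtain ⟨j, hj⟩ := (hlim.eventually_lt_const (half_pos hε)).exists
  refine ⟨N + j * k, fun n hn => ?_⟩
  rw [Real.dist_eq]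
  linarith [key j n hn]

/-- The number `q_t` as a function of a natural number. -/
def qNat (t : ℕ) : ℝ := 1 / 2 * ∏ i ∈ Finset.Icc 2 t, ((i : ℝ) - 1) / (2 ^ i - (i : ℝ) - 1)

theorem q_eq_qNat (t : ℕ+) : q t = qNat t := rfl

theorem qNat_one : qNat 1 = 1 / 2 := by simp [qNat]

theorem qNat_add_two (t : ℕ) :
    qNat (t + 2) = qNat (t + 1) * (((t : ℝ) + 1) / (2 ^ (t + 2) - t - 3)) := by
  rw [qNat, Finset.prod_Icc_succ_top (by omega), ← mul_assoc, ← qNat]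
  push_cast
  ring_nf

theorem add_four_le_two_pow (t : ℕ) : (t : ℝ) + 4 ≤ 2 ^ (t + 2) := by
  have : t + 4 ≤ 2 ^ (t + 2) := by
    induction t with
    | zero => norm_num
    | succ t ih => rw [pow_succ]; omega
  exact_mod_cast this

theorem qNat_pos (t : ℕ) : 0 < qNat (t + 1) := by
  induction t with
  | zero => rw [qNat_one]; norm_num
  | succ t ih =>
    rw [qNat_add_two]
    have := add_four_le_two_pow t
    exact mul_pos ih (div_pos (by positivity) (by linarith))

/-- The limit of `tupleCount t n / 2 ^ n` as a function of `t`. -/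
def tupleDensity (t : ℕ) : ℝ := t * qNat t

theorem tupleDensity_add_two (t : ℕ) :
    (2 ^ (t + 2) - t - 3) * tupleDensity (t + 2) = (t + 2) * tupleDensity (t + 1) := by
  have := add_four_le_two_pow t
  have h : (2 : ℝ) ^ (t + 2) - t - 3 ≠ 0 := by linarith
  rw [tupleDensity, tupleDensity, qNat_add_two]
  push_cast
  field_simp

theorem tupleDensity_fixed (t : ℕ) :
    tupleDensity (t + 2) = ((t : ℝ) + 3) / 2 ^ (t + 2) * tupleDensity (t + 2) +
      ((t : ℝ) + 2) / 2 ^ (t + 2) * tupleDensity (t + 1) := by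
  have h := tupleDensity_add_two t
  field_simp
  linarith

theorem tupleDensity_nonneg (t : ℕ) : 0 ≤ tupleDensity t := by
  rcases t with _ | t
  · simp [tupleDensity]
  · exact mul_nonneg (Nat.cast_nonneg _) (qNat_pos t).le

theorem seven_mul_add_le_two_pow (t : ℕ) : 7 * t + 24 ≤ 3 * 2 ^ (t + 3) := by
  induction t with
  | zero => norm_num
  | succ t ih => rw [show t + 1 + 3 = (t + 3) + 1 by ring, pow_succ]; omega

theorem summable_tupleDensity : Summable tupleDensity := by
  rw [← summable_nat_add_iff 2]
  -- The ratio of the terms at `t + 3` and `t + 2` is `(t + 3) / (2 ^ (t + 3) - t - 4)`, which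
  -- equals `3 / 4` at `t = 0`.
  refine summable_of_ratio_norm_eventually_le (r := 3 / 4) (by norm_num)
    (Eventually.of_forall fun t => ?_)
  have h := tupleDensity_add_two (t + 1)
  rw [Real.norm_of_nonneg (tupleDensity_nonneg _), Real.norm_of_nonneg (tupleDensity_nonneg _)]
  have h0 := tupleDensity_nonneg (t + 3)
  have h1 := tupleDensity_nonneg (t + 2)
  have h2 : 4 * ((t : ℝ) + 3) ≤ 3 * (2 ^ (t + 3) - t - 4) := by
    have : (7 : ℝ) * t + 24 ≤ 3 * 2 ^ (t + 3) := by exact_mod_cast seven_mul_add_le_two_pow t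
    linarith
  push_cast at h
  rw [show t + 1 + 2 = t + 3 by ring, show t + 1 + 1 = t + 2 by ring] at h ⊢
  have h3 : 0 < (2 : ℝ) ^ (t + 3) - t - 4 := by
    have : (0 : ℝ) ≤ t := Nat.cast_nonneg t
    linarith
  refine le_of_mul_le_mul_left ?_ h3
  nlinarith

/-- `tupleCount t n`, normalized by its order of growth. -/
def tupleRatio (t n : ℕ) : ℝ := tupleCount t n / 2 ^ n

theorem tupleRatio_nonneg (t n : ℕ) : 0 ≤ tupleRatio t n := by
  unfold tupleRatio
  positivity

theorem tupleRatio_succ (t n : ℕ) :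
    tupleRatio (t + 1) (n + (t + 1)) = ((t : ℝ) + 2) / 2 ^ (t + 1) * tupleRatio (t + 1) n +
      ((t : ℝ) + 1) / 2 ^ (t + 1) * tupleRatio t n := by
  rw [tupleRatio, tupleRatio, tupleRatio, tupleCount_succ, pow_add _ n]
  push_cast
  field_simp

theorem tupleRatio_of_lt {t n : ℕ} (h : n < t) : tupleRatio t n = 0 := by
  simp [tupleRatio, tupleCount_of_lt h]

/-- For a single run the factor in the recursion is `2 / 2 = 1`, so there is no contraction and this
case is computed exactly. -/
theorem tupleRatio_one_succ (n : ℕ) : tupleRatio 1 (n + 1) = 1 / 2 := by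
  induction n with
  | zero =>
    have := tupleRatio_succ 0 0
    simp only [zero_add] at this
    rw [tupleRatio_of_lt one_pos] at this
    simpa [tupleRatio, tupleCount_zero_zero] using this
  | succ n ih =>
    have := tupleRatio_succ 0 (n + 1)
    simp only [zero_add] at this
    rw [this, ih, show tupleRatio 0 (n + 1) = 0 by simp [tupleRatio, tupleCount_zero_succ]]
    norm_num

theorem tupleDensity_one : tupleDensity 1 = 1 / 2 := by simp [tupleDensity, qNat_one]

/-- The recursion is monotone, starts from `0`, and has the density as its fixed point. The bound is
uniform in `n` and serves as the dominating function. -/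
theorem tupleRatio_le (t n : ℕ) : tupleRatio (t + 1) n ≤ tupleDensity (t + 1) := by
  induction t generalizing n with
  | zero =>
    rw [zero_add, tupleDensity_one]
    rcases n with _ | n
    · rw [tupleRatio_of_lt one_pos]; norm_num
    · rw [tupleRatio_one_succ]
  | succ t iht =>
    induction n using Nat.strong_induction_on with
    | _ n ihn =>
      rcases lt_or_ge n (t + 1 + 1) with h | h
      · rw [tupleRatio_of_lt h]
        exact tupleDensity_nonneg _
      · obtain ⟨m, rfl⟩ := Nat.exists_eq_add_of_le' h
        rw [tupleRatio_succ, tupleDensity_fixed]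
        have h1 := ihn m (by omega)
        have h2 := iht m
        push_cast
        rw [show (t : ℝ) + 1 + 2 = t + 3 by ring, show (t : ℝ) + 1 + 1 = t + 2 by ring]
        gcongr

theorem tendsto_tupleRatio (t : ℕ) : Tendsto (tupleRatio t) atTop (𝓝 (tupleDensity t)) := by
  induction t with
  | zero =>
    rw [← tendsto_add_atTop_iff_nat 1]
    simp [tupleRatio, tupleCount_zero_succ, tupleDensity]
  | succ t ih =>
    rcases t with _ | t
    · rw [← tendsto_add_atTop_iff_nat 1]
      simp [tupleRatio_one_succ, tupleDensity_one]
    · refine tendsto_of_recursion (k := t + 2) (r := ((t : ℝ) + 3) / 2 ^ (t + 2)) (by positivity) ?_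
        (fun n => ?_) (ih.const_mul (((t : ℝ) + 2) / 2 ^ (t + 2))) (tupleDensity_fixed t)
        (C := tupleDensity (t + 2)) fun n => ?_
      · rw [div_lt_one (by positivity)]
        linarith [add_four_le_two_pow t]
      · have := tupleRatio_succ (t + 1) n
        push_cast at this
        rw [show (t : ℝ) + 1 + 2 = t + 3 by ring, show (t : ℝ) + 1 + 1 = t + 2 by ring] at this
        exact this
      · rw [abs_of_nonneg (tupleRatio_nonneg _ _)]
        exact tupleRatio_le _ _

theorem sum_range_div_two_pow_eq_tsum (f : ℕ → ℝ) (n : ℕ) :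
    (∑ t ∈ Finset.range (n + 1), f t * tupleCount t n) / 2 ^ n = ∑' t, f t * tupleRatio t n := by
  rw [tsum_eq_sum (s := Finset.range (n + 1)), Finset.sum_div]
  · exact Finset.sum_congr rfl fun t _ => by rw [tupleRatio, mul_div_assoc]
  · intro t ht
    rw [tupleRatio_of_lt (by simpa using ht), mul_zero]

theorem tendsto_tsum_tupleRatio {f : ℕ → ℝ} (hf0 : ∀ t, 0 ≤ f t) (hf1 : ∀ t, f t ≤ 1) :
    Tendsto (fun n => ∑' t, f t * tupleRatio t n) atTop (𝓝 (∑' t, f t * tupleDensity t)) := by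
  refine tendsto_tsum_of_dominated_convergence summable_tupleDensity
    (fun t => (tendsto_tupleRatio t).const_mul (f t)) ?_
  -- At `n = 0` the empty tuple would violate the bound, as `tupleRatio 0 0 = 1` while the density
  -- at `0` is `0`.
  filter_upwards [eventually_ge_atTop 1] with n hn t
  have h : tupleRatio t n ≤ tupleDensity t := by
    rcases t with _ | t
    · obtain ⟨m, rfl⟩ := Nat.exists_eq_add_of_le' hn
      simp [tupleRatio, tupleCount_zero_succ, tupleDensity]
    · exact tupleRatio_le t n
  rw [Real.norm_of_nonneg (mul_nonneg (hf0 t) (tupleRatio_nonneg t n))]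
  exact (mul_le_of_le_one_left (tupleRatio_nonneg t n) (hf1 t)).trans h

/-- If `s (n + 1) = s n + p n` with `p n ∼ c 2 ^ n`, then `s n ∼ c 2 ^ n`. -/
theorem tendsto_div_two_pow_of_succ {s p : ℕ → ℝ} {c : ℝ} (hs : ∀ n, s (n + 1) = s n + p n)
    (hp : Tendsto (fun n => p n / 2 ^ n) atTop (𝓝 c)) :
    Tendsto (fun n => s n / 2 ^ n) atTop (𝓝 c) := by
  obtain ⟨B, hB⟩ := hp.abs.bddAbove_range
  have hB' : ∀ n, |p n / 2 ^ n| ≤ B := fun n => hB ⟨n, rfl⟩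
  have hrec : ∀ n, s (n + 1) / 2 ^ (n + 1) = 1 / 2 * (s n / 2 ^ n) + 1 / 2 * (p n / 2 ^ n) := by
    intro n
    rw [hs, pow_succ]
    field_simp
  refine tendsto_of_recursion (k := 1) (r := 1 / 2) (by norm_num) (by norm_num) hrec
    (hp.const_mul (1 / 2)) (by ring) (C := max |s 0| B) fun n => ?_
  induction n with
  | zero => simp
  | succ n ih =>
    rw [hrec]
    refine (abs_add_le _ _).trans ?_
    rw [abs_mul, abs_mul, abs_of_pos (by norm_num : (0 : ℝ) < 1 / 2)]
    linarith [(hB' n).trans (le_max_right |s 0| B)]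

/-! ### Block paths and their encoding by runs -/

/-- The total length of a list of blocks; the block `(m, d)` consists of `m + 1` states. -/
def blockCost (bs : List (ℕ × ℕ)) : ℕ := (bs.map fun b => b.1 + 1).sum

/-- The sum of the maxima of a list of finite sets. -/
def runWeight (L : List (Finset ℕ)) : ℕ := (L.map fun A => A.sup id).sum

theorem blockCost_cons (b : ℕ × ℕ) (bs : List (ℕ × ℕ)) :
    blockCost (b :: bs) = b.1 + 1 + blockCost bs := by simp [blockCost]

theorem runWeight_cons (A : Finset ℕ) (L : List (Finset ℕ)) :
    runWeight (A :: L) = A.sup id + runWeight L := by simp [runWeight]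

/-- The differences from which the blocks of a list of blocks are entered, starting at `d`. -/
def sources : ℕ → List (ℕ × ℕ) → List ℕ
  | _, [] => []
  | d, b :: bs => d :: sources b.2 bs

/-- `BlockPath e d bs`: the blocks `bs` describe a path in the state graph from a state with a ball
landing now and the other `d` beats later to such a state with `e` in place of `d`. -/
inductive BlockPath (e : ℕ) : ℕ → List (ℕ × ℕ) → Prop
  | nil : BlockPath e e []
  | cons {d m d' : ℕ} {bs : List (ℕ × ℕ)} (h : d = 0 ∨ m + 1 = d ∨ m + d' + 1 = d)
      (hbs : BlockPath e d' bs) : BlockPath e d ((m, d') :: bs)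

/-- `Encodes e d bs L`: the sets in `L` are the maximal runs of differences visited by the block
path `bs` from `d` to `e` in which the same ball stays in the air. -/
inductive Encodes (e : ℕ) : ℕ → List (ℕ × ℕ) → List (Finset ℕ) → Prop
  | nil : Encodes e e [] []
  | add {d : ℕ} {bs : List (ℕ × ℕ)} {L : List (Finset ℕ)} (m : ℕ) (h : Encodes e d bs L) :
      Encodes e (m + 1) ((m, d) :: bs) ({m + 1} :: L)
  | sub {d : ℕ} {bs : List (ℕ × ℕ)} {A : Finset ℕ} {L : List (Finset ℕ)} (m : ℕ)
      (h : Encodes e d bs (A :: L)) :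
      Encodes e (m + d + 1) ((m, d) :: bs) (insert (m + d + 1) A :: L)

namespace BlockPath

theorem sources_append {e d : ℕ} {bs : List (ℕ × ℕ)} (h : BlockPath e d bs) :
    sources d bs ++ [e] = d :: bs.map Prod.snd := by
  induction h with
  | nil => rfl
  | cons h hbs ih => simp [sources, ih]

theorem sources_perm {e : ℕ} {bs : List (ℕ × ℕ)} (h : BlockPath e e bs) :
    (sources e bs).Perm (bs.map Prod.snd) := by
  have h1 : (e :: sources e bs).Perm (sources e bs ++ [e]) := by
    simpa using List.perm_append_comm (l₁ := [e]) (l₂ := sources e bs)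
  rw [h.sources_append] at h1
  exact h1.cons_inv

/-- The last step must close its run. It could fail to do so only by descending to `e`: if `e` is
the largest difference this is impossible, and if `e = 0` the descending step coincides with a
closing one. -/
theorem exists_encodes {e d : ℕ} {bs : List (ℕ × ℕ)} (h : BlockPath e d bs)
    (h0 : 0 ∉ sources d bs) (he : e = 0 ∨ ∀ x ∈ sources d bs, x ≤ e) :
    ∃ L, Encodes e d bs L := by
  induction h with
  | nil => exact ⟨[], .nil⟩
  | @cons d m d' bs h hbs ih =>
    simp only [sources, List.mem_cons, not_or] at h0 he
    obtain ⟨L, hL⟩ := ih h0.2 (he.imp_right fun he x hx => he x (Or.inr hx))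
    rcases h with rfl | rfl | rfl
    · exact absurd rfl h0.1
    · exact ⟨_, hL.add m⟩
    · rcases L with _ | ⟨A, L⟩
      · cases hL
        rcases he with rfl | he
        · exact ⟨_, .add m .nil⟩
        · have := he _ (Or.inl rfl)
          omega
      · exact ⟨_, hL.sub m⟩

end BlockPath

namespace Encodes

theorem blockPath {e d : ℕ} {bs : List (ℕ × ℕ)} {L : List (Finset ℕ)} (h : Encodes e d bs L) :
    BlockPath e d bs := by
  induction h with
  | nil => exact .nil
  | add m h ih => exact .cons (Or.inr (Or.inl rfl)) ih
  | sub m h ih => exact .cons (Or.inr (Or.inr rfl)) ih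

theorem forall_mem {e d : ℕ} {bs : List (ℕ × ℕ)} {L : List (Finset ℕ)} (h : Encodes e d bs L) :
    ∀ A ∈ L, A.Nonempty ∧ 0 ∉ A := by
  induction h with
  | nil => simp
  | add m h ih => simpa using ih
  | sub m h ih =>
    simp only [List.mem_cons, forall_eq_or_imp] at ih ⊢
    exact ⟨⟨Finset.insert_nonempty _ _, by simpa using ih.1.2⟩, ih.2⟩

theorem sup_head {e d : ℕ} {bs : List (ℕ × ℕ)} {A : Finset ℕ} {L : List (Finset ℕ)}
    (h : Encodes e d bs (A :: L)) : A.sup id = d := by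
  generalize hL : A :: L = L' at h
  induction h generalizing A L with
  | nil => simp at hL
  | add m h ih =>
    obtain ⟨rfl, rfl⟩ := List.cons.inj hL
    simp
  | sub m h ih =>
    obtain ⟨rfl, rfl⟩ := List.cons.inj hL
    rw [Finset.sup_insert, ih rfl]
    simp
    omega

theorem ne_nil {e d : ℕ} {bs : List (ℕ × ℕ)} {A : Finset ℕ} {L : List (Finset ℕ)}
    (h : Encodes e d bs (A :: L)) : bs ≠ [] := by
  rintro rfl
  cases h

theorem notMem_head {e d m : ℕ} {bs : List (ℕ × ℕ)} {A : Finset ℕ} {L : List (Finset ℕ)}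
    (h : Encodes e d bs (A :: L)) : m + d + 1 ∉ A := fun hm => by
  have := Finset.le_sup (f := id) hm
  rw [h.sup_head] at this
  simp at this

/-- A step `add m` contributes a run with maximum `m + 1`; a step `sub m` raises the maximum of the
first run by `m + 1`. -/
theorem blockCost_eq {e d : ℕ} {bs : List (ℕ × ℕ)} {L : List (Finset ℕ)}
    (h : Encodes e d bs L) : blockCost bs = runWeight L := by
  induction h with
  | nil => rfl
  | add m h ih => simp [blockCost_cons, runWeight_cons, ih]
  | sub m h ih =>
    rw [blockCost_cons, ih, runWeight_cons, runWeight_cons, Finset.sup_insert, h.sup_head,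
      sup_of_le_left (by simp; omega)]
    simp
    omega

theorem mem_sources {e d : ℕ} {bs : List (ℕ × ℕ)} {L : List (Finset ℕ)} (h : Encodes e d bs L)
    (x : ℕ) : x ∈ sources d bs ↔ ∃ A ∈ L, x ∈ A := by
  induction h with
  | nil => simp [sources]
  | add m h ih => simp [sources, ih]
  | sub m h ih => simp [sources, ih, or_assoc]

theorem nodup_sources {e d : ℕ} {bs : List (ℕ × ℕ)} {L : List (Finset ℕ)} (h : Encodes e d bs L) :
    (sources d bs).Nodup ↔ L.Pairwise Disjoint := by
  induction h with
  | nil => simp [sources]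
  | add m h ih =>
    simp only [sources, List.nodup_cons, ih, h.mem_sources, List.pairwise_cons,
      Finset.disjoint_singleton_left]
    simp
  | sub m h ih =>
    simp only [sources, List.nodup_cons, ih, h.mem_sources, List.pairwise_cons,
      Finset.disjoint_insert_left]
    have := h.notMem_head (m := m)
    simp only [List.mem_cons, exists_eq_or_imp, this, false_or]
    grind

/-- The first run tells which step comes first: `add` if it is a singleton, `sub` if it has more
elements. -/
theorem left_unique {e d d' : ℕ} {bs bs' : List (ℕ × ℕ)} {L : List (Finset ℕ)}
    (h : Encodes e d bs L) (h' : Encodes e d' bs' L) : d = d' ∧ bs = bs' := by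
  induction h generalizing d' bs' with
  | nil =>
    cases h'
    exact ⟨rfl, rfl⟩
  | @add d bs L m h ih =>
    have hd := h'.sup_head
    generalize hL' : ({m + 1} : Finset ℕ) :: L = L' at h'
    cases h' with
    | nil => simp at hL'
    | add m' h' =>
      obtain ⟨hA, rfl⟩ := List.cons.inj hL'
      obtain ⟨rfl, rfl⟩ := ih h'
      simp_all
    | @sub _ _ A' _ m' h' =>
      obtain ⟨hA, rfl⟩ := List.cons.inj hL'
      obtain ⟨x, hx⟩ := (h'.forall_mem A' (by simp)).1
      have h1 : x ∈ ({m + 1} : Finset ℕ) := hA ▸ Finset.mem_insert_of_mem hx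
      have h2 : m' + _ + 1 ∈ ({m + 1} : Finset ℕ) := hA ▸ Finset.mem_insert_self _ _
      rw [Finset.mem_singleton] at h1 h2
      rw [h1, ← h2] at hx
      exact absurd hx h'.notMem_head
  | @sub d bs A L m h ih =>
    generalize hL' : (insert (m + d + 1) A) :: L = L' at h'
    cases h' with
    | nil => simp at hL'
    | add m' h' =>
      obtain ⟨hA, rfl⟩ := List.cons.inj hL'
      obtain ⟨x, hx⟩ := (h.forall_mem A (by simp)).1
      have h1 : x ∈ ({m' + 1} : Finset ℕ) := hA ▸ Finset.mem_insert_of_mem hx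
      have h2 : m + d + 1 ∈ ({m' + 1} : Finset ℕ) := hA ▸ Finset.mem_insert_self _ _
      rw [Finset.mem_singleton] at h1 h2
      rw [h1, ← h2] at hx
      exact absurd hx h.notMem_head
    | @sub d' bs' A' _ m' h' =>
      have hs := (h.sub m).sup_head
      rw [(List.cons.inj hL').1, (h'.sub m').sup_head] at hs
      obtain ⟨hA, rfl⟩ := List.cons.inj hL'
      have : A = A' := by
        rw [← Finset.erase_insert (h.notMem_head (m := m)), hA, ← hs,
          Finset.erase_insert (h'.notMem_head (m := m'))]
      subst this
      obtain ⟨rfl, rfl⟩ := ih h'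
      have : m = m' := by omega
      subst this
      exact ⟨rfl, rfl⟩

/-- A block fits both `add` and `sub` only if it leads to difference `0`. Then `sub` would need a
following run with maximum `0`, which `pos` excludes. -/
theorem right_unique {e d : ℕ} {bs : List (ℕ × ℕ)} {L L' : List (Finset ℕ)}
    (h : Encodes e d bs L) (h' : Encodes e d bs L') : L = L' := by
  have pos : ∀ {bs A L}, ¬ Encodes e 0 bs (A :: L) := fun {bs A L} h => by
    obtain ⟨⟨x, hx⟩, h0⟩ := h.forall_mem A (by simp)
    have := Finset.le_sup (f := id) hx
    rw [h.sup_head] at this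
    exact h0 (Nat.le_zero.1 this ▸ hx)
  induction h generalizing L' with
  | nil => cases h'; rfl
  | @add d bs L m h ih =>
    generalize hm : m + 1 = m1 at h'
    cases h' with
    | add _ h' => rw [ih h', hm]
    | sub _ h' =>
      have : d = 0 := by omega
      subst this
      exact absurd h' pos
  | @sub d bs A L m h ih =>
    generalize hm : m + d + 1 = m1 at h'
    cases h' with
    | add _ h' =>
      have : d = 0 := by omega
      subst this
      exact absurd h pos
    | sub _ h' =>
      obtain ⟨rfl, rfl⟩ := List.cons.inj (ih h')
      rfl

theorem exists_of_forall_mem (e : ℕ) {L : List (Finset ℕ)} (hL : ∀ A ∈ L, A.Nonempty ∧ 0 ∉ A) :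
    ∃ d bs, Encodes e d bs L := by
  induction L with
  | nil => exact ⟨e, [], .nil⟩
  | cons A L ih =>
    simp only [List.mem_cons, forall_eq_or_imp] at hL
    obtain ⟨⟨hA, h0⟩, hL⟩ := hL
    induction A using Finset.induction_on_max with
    | empty => simp at hA
    | insert a A ha ihA =>
      simp only [Finset.mem_insert, not_or] at h0
      rcases A.eq_empty_or_nonempty with rfl | hne
      · obtain ⟨d, bs, h⟩ := ih hL
        obtain ⟨m, rfl⟩ := Nat.exists_eq_succ_of_ne_zero (Ne.symm h0.1)
        exact ⟨_, _, h.add m⟩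
      · obtain ⟨d, bs, h⟩ := ihA hne h0.2
        obtain ⟨x, hx, hxd⟩ := Finset.exists_mem_eq_sup A hne id
        rw [h.sup_head] at hxd
        have hda : d < a := hxd ▸ ha x hx
        obtain ⟨m, rfl⟩ := Nat.exists_eq_add_of_lt hda
        rw [add_comm d m]
        exact ⟨_, _, h.sub m⟩

end Encodes

/-! ### The two-ball state graph -/

/-- The state with one ball at position `a` and one at position `a + d`. -/
def twoBall (a d : ℕ) : State :=
  Finsupp.single a 1 + Finsupp.single (a + d) 1

theorem twoBall_apply (a d i : ℕ) :
    twoBall a d i = (if a = i then 1 else 0) + if a + d = i then 1 else 0 := by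
  simp [twoBall, Finsupp.single_apply]

theorem twoBall_inj {a d a' d' : ℕ} : twoBall a d = twoBall a' d' ↔ a = a' ∧ d = d' := by
  refine ⟨fun h => ?_, by rintro ⟨rfl, rfl⟩; rfl⟩
  have key : ∀ i, twoBall a d i = twoBall a' d' i := fun i => by rw [h]
  simp only [twoBall_apply] at key
  have h1 := key a
  have h2 := key a'
  have ha : a = a' := by split_ifs at h1 h2 <;> omega
  subst ha
  have h3 := key (a + d)
  have h4 := key (a + d')
  refine ⟨rfl, ?_⟩
  split_ifs at h3 h4 <;> omega

theorem numBalls_twoBall (a d : ℕ) : (twoBall a d).numBalls = 2 := by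
  rw [State.numBalls, twoBall, Finsupp.sum_add_index' (by simp) (by simp)]
  simp

theorem mem_multiplexStates_iff {α : State} :
    α ∈ multiplexStates 2 2 ↔ ∃ a d, α = twoBall a d := by
  constructor
  · rintro ⟨-, h⟩
    have hc : Multiset.card (Finsupp.toMultiset α) = 2 := by
      rw [Finsupp.card_toMultiset]
      exact h
    obtain ⟨x, y, hxy⟩ := Multiset.card_eq_two.1 hc
    have e : α = Finsupp.single x 1 + Finsupp.single y 1 := by
      apply AddEquiv.injective (Multiset.toFinsupp (α := ℕ)).symm
      simpa [Multiset.toFinsupp] using hxy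
    rcases le_total x y with hle | hle
    · obtain ⟨d, rfl⟩ := Nat.exists_eq_add_of_le hle
      exact ⟨x, d, e⟩
    · obtain ⟨d, rfl⟩ := Nat.exists_eq_add_of_le hle
      exact ⟨y, d, by rw [e, add_comm, twoBall]⟩
  · rintro ⟨a, d, rfl⟩
    refine ⟨fun i => ?_, numBalls_twoBall a d⟩
    rw [twoBall_apply]
    split_ifs <;> omega

theorem twoBall_mem_multiplexStates (a d : ℕ) : twoBall a d ∈ multiplexStates 2 2 :=
  mem_multiplexStates_iff.2 ⟨a, d, rfl⟩

theorem twoBall_mem_normalStates_iff {a d : ℕ} : twoBall a d ∈ normalStates 2 ↔ d ≠ 0 := by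
  constructor
  · rintro ⟨h, -⟩ rfl
    have := h a
    simp [twoBall_apply] at this
  · intro hd
    refine ⟨fun i => ?_, numBalls_twoBall a d⟩
    rw [twoBall_apply]
    split_ifs <;> omega

theorem normalStates_subset : normalStates 2 ⊆ multiplexStates 2 2 := fun α hα =>
  ⟨fun i => by rcases hα.1 i with h | h <;> omega, hα.2⟩

theorem transition_succ_iff {a d a' d' : ℕ} :
    Transition (twoBall (a + 1) d) (twoBall a' d') ↔ a' = a ∧ d' = d := by
  simp only [Transition, twoBall_apply]
  constructor
  · intro h
    have h1 := h a
    have h2 := h (a + d)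
    split_ifs at h1 h2 <;> omega
  · rintro ⟨rfl, rfl⟩ i
    split_ifs <;> omega

theorem transition_zero_iff {d a' d' : ℕ} :
    Transition (twoBall 0 d) (twoBall a' d') ↔ d = 0 ∨ a' + 1 = d ∨ a' + d' + 1 = d := by
  simp only [Transition, twoBall_apply]
  constructor
  · intro h
    have h1 := h (d - 1)
    split_ifs at h1 <;> omega
  · intro h i
    have h0 : (if 0 = i + 1 then 1 else 0) = 0 := if_neg (by omega)
    rw [h0]
    rcases h with h | h | h <;> split_ifs <;> omega

/-- The states through which `twoBall m d` comes down to `twoBall 0 d`. -/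
def block : ℕ → ℕ → List State
  | 0, d => [twoBall 0 d]
  | m + 1, d => twoBall (m + 1) d :: block m d

/-- The list of states described by a list of blocks. -/
def blockStates (bs : List (ℕ × ℕ)) : List State := bs.flatMap fun b => block b.1 b.2

theorem blockStates_nil : blockStates [] = [] := rfl

theorem length_block (m d : ℕ) : (block m d).length = m + 1 := by
  induction m with
  | zero => rfl
  | succ m ih => simp [block, ih]

theorem mem_block {m d : ℕ} {α : State} : α ∈ block m d ↔ ∃ a ≤ m, α = twoBall a d := by
  induction m with
  | zero => simp [block]
  | succ m ih => simp [block, ih, Nat.le_succ_iff_eq_or_le]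

theorem nodup_block (m d : ℕ) : (block m d).Nodup := by
  induction m with
  | zero => simp [block]
  | succ m ih =>
    simp only [block, List.nodup_cons, ih, mem_block, twoBall_inj, and_true]
    rintro ⟨a, ha, rfl, -⟩
    omega

theorem length_blockStates (bs : List (ℕ × ℕ)) : (blockStates bs).length = blockCost bs := by
  simp [blockStates, blockCost, List.length_flatMap, length_block]

theorem exists_of_mem_blockStates {bs : List (ℕ × ℕ)} {α : State} (h : α ∈ blockStates bs) :
    ∃ a, ∃ d ∈ bs.map Prod.snd, α = twoBall a d := by
  obtain ⟨b, hb, hα⟩ := List.mem_flatMap.1 h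
  obtain ⟨a, -, rfl⟩ := mem_block.1 hα
  exact ⟨a, b.2, List.mem_map_of_mem hb, rfl⟩

theorem twoBall_zero_mem_blockStates {bs : List (ℕ × ℕ)} {d : ℕ} :
    twoBall 0 d ∈ blockStates bs ↔ d ∈ bs.map Prod.snd := by
  constructor
  · intro h
    obtain ⟨a, d', hd', e⟩ := exists_of_mem_blockStates h
    rwa [(twoBall_inj.1 e).2]
  · intro h
    obtain ⟨b, hb, rfl⟩ := List.mem_map.1 h
    exact List.mem_flatMap.2 ⟨b, hb, mem_block.2 ⟨0, Nat.zero_le _, rfl⟩⟩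

/-- All blocks with difference `d` share the state `twoBall 0 d`, and blocks with different
differences are disjoint. -/
theorem nodup_blockStates {bs : List (ℕ × ℕ)} :
    (blockStates bs).Nodup ↔ (bs.map Prod.snd).Nodup := by
  rw [blockStates, List.nodup_flatMap, List.nodup_iff_pairwise_ne (l := bs.map _), List.pairwise_map]
  constructor
  · rintro ⟨-, h⟩
    refine h.imp fun {b b'} hd e => ?_
    exact hd (mem_block.2 ⟨0, Nat.zero_le _, rfl⟩) (mem_block.2 ⟨0, Nat.zero_le _, by rw [e]⟩)
  · intro h
    refine ⟨fun b _ => nodup_block _ _, h.imp fun {b b'} hd α h1 h2 => ?_⟩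
    obtain ⟨a, -, rfl⟩ := mem_block.1 h1
    obtain ⟨a', -, e⟩ := mem_block.1 h2
    exact hd (twoBall_inj.1 e).2

theorem block_append_inj {m d m' d' : ℕ} {l l' : List State}
    (h : block m d ++ l = block m' d' ++ l') : m = m' ∧ d = d' ∧ l = l' := by
  have h1 : ∀ m d (l : List State), ∃ l₁, block m d ++ l = twoBall m d :: l₁ := by
    rintro (_ | m) d l <;> exact ⟨_, rfl⟩
  obtain ⟨l₁, e₁⟩ := h1 m d l
  obtain ⟨l₂, e₂⟩ := h1 m' d' l'
  have := h
  rw [e₁, e₂] at this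
  obtain ⟨rfl, rfl⟩ := twoBall_inj.1 (List.cons.inj this).1
  exact ⟨rfl, rfl, List.append_cancel_left h⟩

theorem blockStates_injective : Function.Injective blockStates := by
  have hne : ∀ b bs, blockStates (b :: bs) ≠ [] := fun b bs h => by
    have := congrArg List.length h
    simp [length_blockStates, blockCost_cons] at this
  intro bs
  induction bs with
  | nil =>
    rintro (_ | ⟨b, bs⟩) h
    · rfl
    · exact absurd h.symm (hne b bs)
  | cons b bs ih =>
    rintro (_ | ⟨b', bs'⟩) h
    · exact absurd h (hne b bs)
    · obtain ⟨h1, h2, h3⟩ := block_append_inj h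
      rw [ih h3, Prod.ext h1 h2]

theorem isChain_cons_block_append {α : State} {m d : ℕ} {l : List State}
    (hα : Transition α (twoBall m d)) (hl : List.IsChain Transition (twoBall 0 d :: l)) :
    List.IsChain Transition (α :: (block m d ++ l)) := by
  induction m generalizing α with
  | zero => exact List.isChain_cons_cons.2 ⟨hα, hl⟩
  | succ m ih => exact List.isChain_cons_cons.2 ⟨hα, ih (transition_succ_iff.2 ⟨rfl, rfl⟩)⟩

theorem getLast?_cons_block_append (α : State) (m d : ℕ) (l : List State) :
    (α :: (block m d ++ l)).getLast? = (twoBall 0 d :: l).getLast? := by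
  induction m generalizing α with
  | zero => exact List.getLast?_cons_cons
  | succ m ih => exact List.getLast?_cons_cons.trans (ih _)

theorem BlockPath.isChain {e d : ℕ} {bs : List (ℕ × ℕ)} (h : BlockPath e d bs) :
    List.IsChain Transition (twoBall 0 d :: blockStates bs) ∧
      (twoBall 0 d :: blockStates bs).getLast? = some (twoBall 0 e) := by
  induction h with
  | nil => simp [blockStates_nil]
  | cons h hbs ih =>
    exact ⟨isChain_cons_block_append (transition_zero_iff.2 h) ih.1,
      (getLast?_cons_block_append _ _ _ _).trans ih.2⟩

theorem exists_eq_block_append {e a d : ℕ} {l : List State}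
    (hl : ∀ α ∈ l, α ∈ multiplexStates 2 2) (hc : List.IsChain Transition (twoBall a d :: l))
    (he : (twoBall a d :: l).getLast? = some (twoBall 0 e)) :
    ∃ l', twoBall a d :: l = block a d ++ l' ∧ List.IsChain Transition (twoBall 0 d :: l') ∧
      (twoBall 0 d :: l').getLast? = some (twoBall 0 e) := by
  induction a generalizing l with
  | zero => exact ⟨l, rfl, hc, he⟩
  | succ a ih =>
    rcases l with _ | ⟨β, l⟩
    · simp [twoBall_inj] at he
    · obtain ⟨a', d', rfl⟩ := mem_multiplexStates_iff.1 (hl β (by simp))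
      rw [List.isChain_cons_cons] at hc
      obtain ⟨rfl, rfl⟩ := transition_succ_iff.1 hc.1
      rw [List.getLast?_cons_cons] at he
      obtain ⟨l', h1, h2⟩ := ih (fun α hα => hl α (by simp [hα])) hc.2 he
      exact ⟨l', by rw [h1]; rfl, h2⟩

/-- Each throw starts a block whose descent is forced. The prescribed last state ensures that the
final block is complete. -/
theorem exists_blockPath {e d : ℕ} {l : List State} (hl : ∀ α ∈ l, α ∈ multiplexStates 2 2)
    (hc : List.IsChain Transition (twoBall 0 d :: l))
    (he : (twoBall 0 d :: l).getLast? = some (twoBall 0 e)) :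
    ∃ bs, BlockPath e d bs ∧ l = blockStates bs := by
  induction hn : l.length using Nat.strong_induction_on generalizing l d with
  | _ n ih =>
    rcases l with _ | ⟨α, l⟩
    · have : d = e := by simpa [twoBall_inj] using he
      subst this
      exact ⟨[], .nil, rfl⟩
    · obtain ⟨m, d', rfl⟩ := mem_multiplexStates_iff.1 (hl α (by simp))
      rw [List.isChain_cons_cons] at hc
      rw [List.getLast?_cons_cons] at he
      obtain ⟨l', h1, h2, h3⟩ :=
        exists_eq_block_append (fun α hα => hl α (by simp [hα])) hc.2 he
      have hlen : l'.length < n := by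
        rw [← hn, h1, List.length_append, length_block]
        omega
      obtain ⟨bs, hbs, rfl⟩ := ih _ hlen
        (fun α hα => hl α (by rw [h1]; exact List.mem_append_right _ hα)) h2 h3 rfl
      exact ⟨(m, d') :: bs, .cons (transition_zero_iff.1 hc.1) hbs, h1⟩

/-! ### Cutting cycles open at a state -/

theorem cycle_exists_eq_coe_append_singleton {α : Type*} {ρ : Cycle α} {x : α} (h : x ∈ ρ) :
    ∃ l : List α, ρ = ↑(l ++ [x]) := by
  induction ρ using Quotient.inductionOn' with
  | _ l =>
    obtain ⟨s, t, rfl⟩ := List.append_of_mem (Cycle.mem_coe_iff.1 h)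
    refine ⟨t ++ s, Cycle.coe_eq_coe.2 ?_⟩
    simpa using List.isRotated_append (l := s ++ [x]) (l' := t)

theorem cycle_chain_coe_append_singleton {α : Type*} (r : α → α → Prop) (l : List α) (x : α) :
    Cycle.Chain r ↑(l ++ [x]) ↔ List.IsChain r (x :: (l ++ [x])) := by
  rw [← Cycle.chain_coe_cons, Cycle.coe_eq_coe.2 (List.isRotated_append (l := l) (l' := [x])),
    List.singleton_append]

/-- The element `x` occurs only once, so only one rotation ends in it: cutting a prime pattern at a
given state is unambiguous. -/
theorem eq_of_isRotated_append_singleton {α : Type*} {l l' : List α} {x : α}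
    (hl : (l ++ [x]).Nodup) (h : (l ++ [x]) ~r (l' ++ [x])) : l = l' := by
  obtain ⟨n, hn, h⟩ := List.isRotated_iff_mod.1 h
  rw [List.rotate_eq_drop_append_take hn] at h
  have e := List.take_append_drop n (l ++ [x])
  generalize (l ++ [x]).take n = a at h e
  generalize (l ++ [x]).drop n = b at h e
  rcases List.eq_nil_or_concat' a with rfl | ⟨a, y, rfl⟩
  · rw [List.append_nil] at h
    rw [List.nil_append] at e
    exact List.append_cancel_right (e.symm.trans h)
  rcases List.eq_nil_or_concat' b with rfl | ⟨b, z, rfl⟩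
  · rw [List.nil_append] at h
    rw [List.append_nil] at e
    exact List.append_cancel_right (e.symm.trans h)
  rw [← List.append_assoc] at h e
  have hz := (List.append_inj' e rfl).2
  have hy := (List.append_inj' h rfl).2
  rw [← e, hz, hy] at hl
  simp [List.nodup_append] at hl

theorem twoBall_zero_mem_of_mem {ρ : Cycle State} (hρ : ∀ α ∈ ρ, α ∈ multiplexStates 2 2)
    (hc : ρ.Chain Transition) {a d : ℕ} (h : twoBall a d ∈ ρ) : twoBall 0 d ∈ ρ := by
  induction a with
  | zero => exact h
  | succ a ih =>
    apply ih
    obtain ⟨l, rfl⟩ := cycle_exists_eq_coe_append_singleton h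
    rw [cycle_chain_coe_append_singleton] at hc
    rcases hl : l ++ [twoBall (a + 1) d] with _ | ⟨β, l'⟩
    · simp at hl
    · simp only [hl] at hc hρ ⊢
      obtain ⟨a', d', rfl⟩ := mem_multiplexStates_iff.1 (hρ β (by simp))
      obtain ⟨rfl, rfl⟩ := transition_succ_iff.1 (List.isChain_cons_cons.1 hc).1
      simp

theorem BlockPath.exists_eq_append {e : ℕ} {bs : List (ℕ × ℕ)} (h : BlockPath e e bs)
    (hne : bs ≠ []) : ∃ l, blockStates bs = l ++ [twoBall 0 e] := by
  have := h.isChain.2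
  rcases hl : blockStates bs with _ | ⟨β, l⟩
  · exact absurd (blockStates_injective (hl.trans blockStates_nil.symm)) hne
  · rwa [hl, List.getLast?_cons_cons, List.getLast?_eq_some_iff] at this

theorem BlockPath.mem_multiplexPrimePatterns {e : ℕ} {bs : List (ℕ × ℕ)} (h : BlockPath e e bs)
    (hne : bs ≠ []) (hn : (bs.map Prod.snd).Nodup) :
    (blockStates bs : Cycle State) ∈ multiplexPrimePatterns 2 (blockCost bs) 2 := by
  refine ⟨?_, ?_, ?_, ?_⟩
  · rw [Cycle.length_coe, length_blockStates]
  · rwa [Cycle.nodup_coe_iff, nodup_blockStates]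
  · intro α hα
    obtain ⟨a, d, -, rfl⟩ := exists_of_mem_blockStates (Cycle.mem_coe_iff.1 hα)
    exact twoBall_mem_multiplexStates a d
  · obtain ⟨l, hl⟩ := h.exists_eq_append hne
    have := h.isChain.1
    rw [hl] at this ⊢
    rwa [cycle_chain_coe_append_singleton]

theorem exists_blockPath_of_mem {e n : ℕ} {ρ : Cycle State}
    (hρ : ρ ∈ multiplexPrimePatterns 2 n 2) (he : twoBall 0 e ∈ ρ) :
    ∃ bs, BlockPath e e bs ∧ bs ≠ [] ∧ (bs.map Prod.snd).Nodup ∧ blockCost bs = n ∧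
      ρ = blockStates bs := by
  obtain ⟨l, rfl⟩ := cycle_exists_eq_coe_append_singleton he
  obtain ⟨h1, h2, h3, h4⟩ := hρ
  rw [cycle_chain_coe_append_singleton] at h4
  obtain ⟨bs, hbs, hl⟩ := exists_blockPath (e := e) (fun α hα => h3 α (Cycle.mem_coe_iff.2 hα)) h4
    (by rw [← List.cons_append, List.getLast?_concat])
  refine ⟨bs, hbs, ?_, ?_, ?_, by rw [hl]⟩
  · rintro rfl
    simp [blockStates_nil] at hl
  · rwa [← nodup_blockStates, ← hl, ← Cycle.nodup_coe_iff]
  · rw [← length_blockStates, ← hl, ← h1, Cycle.length_coe]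

theorem BlockPath.eq_of_coe_eq {e : ℕ} {bs bs' : List (ℕ × ℕ)} (h : BlockPath e e bs)
    (h' : BlockPath e e bs') (hne : bs ≠ []) (hne' : bs' ≠ [])
    (hn : (bs.map Prod.snd).Nodup) (heq : (blockStates bs : Cycle State) = blockStates bs') :
    bs = bs' := by
  rw [← nodup_blockStates] at hn
  apply blockStates_injective
  obtain ⟨l, hl⟩ := h.exists_eq_append hne
  obtain ⟨l', hl'⟩ := h'.exists_eq_append hne'
  rw [hl, hl', Cycle.coe_eq_coe] at heq
  rw [hl] at hn
  rw [hl, hl', eq_of_isRotated_append_singleton hn heq]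

/-- A non-normal state has difference `0`, and its forced descent ends in `twoBall 0 0`. -/
theorem mem_strictMultiplexPrimePatterns_iff {n : ℕ} {ρ : Cycle State} :
    ρ ∈ strictMultiplexPrimePatterns n ↔
      ρ ∈ multiplexPrimePatterns 2 n 2 ∧ twoBall 0 0 ∈ ρ := by
  constructor
  · rintro ⟨h, hn⟩
    refine ⟨h, ?_⟩
    have : ∃ α ∈ ρ, α ∉ normalStates 2 := by
      by_contra! hcon
      exact hn ⟨h.1, h.2.1, hcon, h.2.2.2⟩
    obtain ⟨α, hα, hαn⟩ := this
    obtain ⟨a, d, rfl⟩ := mem_multiplexStates_iff.1 (h.2.2.1 α hα)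
    rw [twoBall_mem_normalStates_iff, not_not] at hαn
    subst hαn
    exact twoBall_zero_mem_of_mem h.2.2.1 h.2.2.2 hα
  · rintro ⟨h, h0⟩
    exact ⟨h, fun hn => twoBall_mem_normalStates_iff.1 (hn.2.2.1 _ h0) rfl⟩

theorem normalPrimePatterns_subset (n : ℕ) :
    normalPrimePatterns 2 n ⊆ multiplexPrimePatterns 2 n 2 := fun _ h =>
  ⟨h.1, h.2.1, fun α hα => normalStates_subset (h.2.2.1 α hα), h.2.2.2⟩

/-! ### Prime patterns as lists of runs -/

/-- The lists of pairwise disjoint nonempty finite sets of positive integers whose maxima add up to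
`n`. -/
def runLists (n : ℕ) : Set (List (Finset ℕ)) :=
  {L | (∀ A ∈ L, A.Nonempty ∧ 0 ∉ A) ∧ L.Pairwise Disjoint ∧ runWeight L = n}

/-- The nonempty lists in `runLists n` whose first set has the largest maximum. -/
def leadingLists (n : ℕ) : Set (List (Finset ℕ)) :=
  {L ∈ runLists n | ∃ A L', L = A :: L' ∧ ∀ B ∈ L, B.sup id ≤ A.sup id}

theorem nonempty_equiv_of_relation {α β : Type*} {s : Set α} {t : Set β} (R : α → β → Prop)
    (hs : ∀ a ∈ s, ∃ b ∈ t, R a b) (ht : ∀ b ∈ t, ∃ a ∈ s, R a b)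
    (hl : ∀ a a' b, R a b → R a' b → a = a') (hr : ∀ a b b', R a b → R a b' → b = b') :
    Nonempty (s ≃ t) := by
  choose f hft hfR using hs
  refine ⟨Equiv.ofBijective (fun a : s => (⟨f a a.2, hft a a.2⟩ : t)) ⟨fun a a' e => ?_, ?_⟩⟩
  · exact Subtype.ext (hl a a' (f a a.2) (hfR a a.2)
      (by rw [Subtype.mk.inj e]; exact hfR a' a'.2))
  · rintro ⟨b, hb⟩
    obtain ⟨a, ha, hab⟩ := ht b hb
    exact ⟨⟨a, ha⟩, Subtype.ext (hr a _ _ (hfR a ha) hab)⟩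

/-- Cut at `twoBall 0 0`. The first block `(m, d)` has unrestricted height, so a list of weight `k <
n` extends to period `n` by the unique choice `m = n - 1 - k`. -/
theorem nonempty_strictMultiplexPrimePatterns_equiv (n : ℕ) :
    Nonempty (strictMultiplexPrimePatterns n ≃ ↥(⋃ k ∈ Set.Iio n, runLists k)) := by
  have hcons : ∀ {d m L} {bs : List (ℕ × ℕ)}, Encodes 0 d bs L →
      BlockPath 0 0 ((m, d) :: bs) := fun h => .cons (Or.inl rfl) h.blockPath
  have hnodup : ∀ {d m L} {bs : List (ℕ × ℕ)}, Encodes 0 d bs L →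
      ((((m, d) :: bs).map Prod.snd).Nodup ↔ L.Pairwise Disjoint) := fun {d m L bs} h => by
    rw [← ((hcons h).sources_perm (bs := (m, d) :: bs)).nodup_iff, sources, List.nodup_cons,
      h.nodup_sources, and_iff_right]
    rw [h.mem_sources]
    rintro ⟨A, hA, h0⟩
    exact (h.forall_mem A hA).2 h0
  refine nonempty_equiv_of_relation (fun ρ L => L.Pairwise Disjoint ∧ ∃ d bs m, Encodes 0 d bs L ∧
    m + 1 + blockCost bs = n ∧ ρ = blockStates ((m, d) :: bs)) ?_ ?_ ?_ ?_
  · intro ρ hρ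
    rw [mem_strictMultiplexPrimePatterns_iff] at hρ
    obtain ⟨bs, h1, h2, h3, h4, rfl⟩ := exists_blockPath_of_mem hρ.1 hρ.2
    cases h1 with
    | nil => exact absurd rfl h2
    | @cons _ m d bs h hbs =>
      have h3' := h3
      rw [← (BlockPath.cons h hbs).sources_perm.nodup_iff, sources, List.nodup_cons] at h3'
      obtain ⟨L, hL⟩ := hbs.exists_encodes h3'.1 (Or.inl rfl)
      rw [hnodup hL] at h3
      rw [blockCost_cons] at h4
      refine ⟨L, ?_, h3, d, bs, m, hL, h4, rfl⟩
      rw [hL.blockCost_eq] at h4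
      exact Set.mem_biUnion (x := runWeight L) (by simp; omega) ⟨hL.forall_mem, h3, rfl⟩
  · intro L hL
    simp only [Set.mem_iUnion] at hL
    obtain ⟨k, hk, h1, h2, rfl⟩ := hL
    obtain ⟨d, bs, h⟩ := Encodes.exists_of_forall_mem 0 h1
    rw [← h.blockCost_eq] at hk
    obtain ⟨m, hm⟩ : ∃ m, m + 1 + blockCost bs = n :=
      ⟨n - 1 - blockCost bs, by simp at hk; omega⟩
    refine ⟨_, ?_, h2, d, bs, m, h, hm, rfl⟩
    rw [mem_strictMultiplexPrimePatterns_iff]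
    have hn := (hnodup (m := m) h).2 h2
    have := (hcons (m := m) h).mem_multiplexPrimePatterns (by simp) hn
    rw [blockCost_cons, hm] at this
    refine ⟨this, ?_⟩
    rw [Cycle.mem_coe_iff, twoBall_zero_mem_blockStates,
      ← (hcons (m := m) h).sources_perm.mem_iff, sources]
    simp
  · rintro ρ ρ' L ⟨-, d, bs, m, h1, h2, rfl⟩ ⟨-, d', bs', m', h1', h2', rfl⟩
    obtain ⟨rfl, rfl⟩ := h1.left_unique h1'
    have : m = m' := by omega
    rw [this]
  · rintro ρ L L' ⟨h, d, bs, m, h1, h2, rfl⟩ ⟨-, d', bs', m', h1', h2', e⟩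
    have := (hcons h1).eq_of_coe_eq (hcons h1') (by simp) (by simp) ((hnodup h1).2 h) e
    simp only [List.cons.injEq, Prod.mk.injEq] at this
    obtain ⟨⟨rfl, rfl⟩, rfl⟩ := this
    exact h1.right_unique h1'

/-- Cut at `twoBall 0 d` with `d` the largest difference: no step descends to `d`, so no run is
split by the cut, and the first run has maximum `d`. -/
theorem nonempty_normalPrimePatterns_equiv {n : ℕ} (hn : 0 < n) :
    Nonempty (normalPrimePatterns 2 n ≃ leadingLists n) := by
  have hmem : ∀ {d L bs}, Encodes d d bs L → ∀ x, x ∈ bs.map Prod.snd ↔ ∃ A ∈ L, x ∈ A :=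
    fun h x => by rw [← h.mem_sources, h.blockPath.sources_perm.mem_iff]
  have hnodup : ∀ {d L bs}, Encodes d d bs L →
      ((bs.map Prod.snd).Nodup ↔ L.Pairwise Disjoint) := fun h => by
    rw [← h.nodup_sources, h.blockPath.sources_perm.nodup_iff]
  refine nonempty_equiv_of_relation (fun ρ L => L ∈ leadingLists n ∧ ∃ d bs, Encodes d d bs L ∧
    ρ = blockStates bs) ?_ ?_ ?_ ?_
  · intro ρ hρ
    have hρ' := normalPrimePatterns_subset n hρ
    obtain ⟨d, hd, hmax⟩ : ∃ d, twoBall 0 d ∈ ρ ∧ ∀ d', twoBall 0 d' ∈ ρ → d' ≤ d := by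
      have hfin : {d | twoBall 0 d ∈ ρ}.Finite := by
        induction ρ using Quotient.inductionOn' with
        | _ l =>
          refine Set.Finite.preimage (f := twoBall 0) (s := {α | α ∈ l}) ?_ (List.finite_toSet l)
          intro d _ d' _ e
          exact (twoBall_inj.1 e).2
      have hne : {d | twoBall 0 d ∈ ρ}.Nonempty := by
        have : ∃ α, α ∈ ρ := by
          induction ρ using Quotient.inductionOn' with
          | _ l =>
            rcases l with _ | ⟨α, l⟩
            · exact absurd hρ.1 (by simpa using hn.ne)
            · exact ⟨α, Cycle.mem_coe_iff.2 (by simp)⟩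
        obtain ⟨α, hα⟩ := this
        obtain ⟨a, d, rfl⟩ := mem_multiplexStates_iff.1 (hρ'.2.2.1 α hα)
        exact ⟨d, twoBall_zero_mem_of_mem hρ'.2.2.1 hρ'.2.2.2 hα⟩
      obtain ⟨d, hd, h⟩ := Set.exists_max_image _ id hfin hne
      exact ⟨d, hd, h⟩
    obtain ⟨bs, h1, h2, h3, h4, rfl⟩ := exists_blockPath_of_mem hρ' hd
    have hsrc : ∀ x, x ∈ sources d bs ↔ twoBall 0 x ∈ (blockStates bs : Cycle State) := fun x => by
      rw [Cycle.mem_coe_iff, twoBall_zero_mem_blockStates, h1.sources_perm.mem_iff]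
    obtain ⟨L, hL⟩ := h1.exists_encodes
      (fun h0 => twoBall_mem_normalStates_iff.1 (hρ.2.2.1 _ ((hsrc 0).1 h0)) rfl)
      (Or.inr fun x hx => hmax x ((hsrc x).1 hx))
    have hlead : L ∈ leadingLists n := by
      refine ⟨⟨hL.forall_mem, (hnodup hL).1 h3, by rw [← hL.blockCost_eq, h4]⟩, ?_⟩
      rcases L with _ | ⟨A, L⟩
      · cases hL
        exact absurd rfl h2
      · refine ⟨A, L, rfl, fun B hB => ?_⟩
        rw [hL.sup_head]
        exact Finset.sup_le fun x hx => hmax x ((hsrc x).1 ((hL.mem_sources x).2 ⟨B, hB, hx⟩))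
    exact ⟨L, hlead, hlead, d, bs, hL, rfl⟩
  · intro L hL
    obtain ⟨⟨h1, h2, h3⟩, A, L', rfl, hA⟩ := hL
    obtain ⟨d, bs, h⟩ := Encodes.exists_of_forall_mem (A.sup id) h1
    obtain rfl := h.sup_head
    have hne := h.ne_nil
    refine ⟨_, ?_, ⟨⟨h1, h2, h3⟩, A, L', rfl, hA⟩, _, bs, h, rfl⟩
    have := h.blockPath.mem_multiplexPrimePatterns hne ((hnodup h).2 h2)
    rw [h.blockCost_eq, h3] at this
    refine ⟨this.1, this.2.1, fun α hα => ?_, this.2.2.2⟩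
    obtain ⟨a, d, hd, rfl⟩ := exists_of_mem_blockStates (Cycle.mem_coe_iff.1 hα)
    rw [twoBall_mem_normalStates_iff]
    rintro rfl
    obtain ⟨B, hB, h0⟩ := (hmem h 0).1 hd
    exact (h1 B hB).2 h0
  · rintro ρ ρ' L ⟨hL, d, bs, h, rfl⟩ ⟨-, d', bs', h', rfl⟩
    obtain ⟨-, A, L', rfl, -⟩ := hL
    obtain rfl : d = d' := h.sup_head.symm.trans h'.sup_head
    rw [(h.left_unique h').2]
  · rintro ρ L L' ⟨hL, d, bs, h, rfl⟩ ⟨hL', d', bs', h', e⟩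
    have hne : ∀ {d L bs}, L ∈ leadingLists n → Encodes d d bs L → bs ≠ [] := by
      rintro d L bs ⟨-, A, L', rfl, -⟩ h
      exact h.ne_nil
    have hle : ∀ {d L bs}, L ∈ leadingLists n → Encodes d d bs L →
        ∀ x, twoBall 0 x ∈ blockStates bs → x ≤ d := by
      rintro d L bs ⟨-, A, L', rfl, hA⟩ h x hx
      rw [twoBall_zero_mem_blockStates, hmem h] at hx
      obtain ⟨B, hB, hx⟩ := hx
      have := hA B hB
      rw [h.sup_head] at this
      exact (Finset.le_sup (f := id) hx).trans this
    have hroot : ∀ {d L bs}, L ∈ leadingLists n → Encodes d d bs L →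
        twoBall 0 d ∈ blockStates bs := by
      intro d L bs hL h
      obtain ⟨l, hl⟩ := h.blockPath.exists_eq_append (hne hL h)
      simp [hl]
    have hiff : ∀ x, x ∈ blockStates bs ↔ x ∈ blockStates bs' := fun x => by
      rw [← Cycle.mem_coe_iff, e, Cycle.mem_coe_iff]
    -- Both `d` and `d'` are the largest difference of the same cycle.
    obtain rfl : d = d' := le_antisymm (hle hL' h' _ ((hiff _).1 (hroot hL h)))
      (hle hL h _ ((hiff _).2 (hroot hL' h')))
    have := h.blockPath.eq_of_coe_eq h'.blockPath (hne hL h) (hne hL' h')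
      ((hnodup h).2 hL.1.2.1) e
    subst this
    exact h.right_unique h'

/-! ### Counting lists by their length -/

theorem ofFn_mem_runLists_iff {t n : ℕ} {A : Fin t → Finset ℕ} :
    List.ofFn A ∈ runLists n ↔ A ∈ runTuples t n := by
  simp only [runLists, runTuples, Set.mem_ofPred_eq, List.forall_mem_ofFn_iff, List.pairwise_ofFn,
    runWeight, List.map_ofFn, List.sum_ofFn, Function.comp_def, forall_and, and_assoc]
  refine and_congr_right fun _ => and_congr_right fun _ => and_congr_left fun _ => ?_
  constructor
  · intro h i j hij
    rcases lt_or_gt_of_ne hij with hlt | hlt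
    · exact h hlt
    · exact (h hlt).symm
  · exact fun h i j hij => h hij.ne

theorem ofFn_mem_leadingLists_iff {t n : ℕ} {A : Fin (t + 1) → Finset ℕ} :
    List.ofFn A ∈ leadingLists n ↔ A ∈ leadingTuples t n := by
  simp only [leadingLists, leadingTuples, Set.mem_ofPred_eq, ofFn_mem_runLists_iff,
    List.forall_mem_ofFn_iff]
  refine and_congr_right fun _ => ?_
  rw [List.ofFn_succ]
  constructor
  · rintro ⟨B, L, h, hB⟩
    rwa [(List.cons.inj h).1]
  · exact fun h => ⟨A 0, _, rfl, h⟩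

theorem setOf_length_eq_image (S : Set (List (Finset ℕ))) (t : ℕ) :
    {L ∈ S | L.length = t} = List.ofFn '' {A : Fin t → Finset ℕ | List.ofFn A ∈ S} := by
  ext L
  constructor
  · rintro ⟨hL, rfl⟩
    exact ⟨L.get, by simpa using hL, List.ofFn_get L⟩
  · rintro ⟨A, hA, rfl⟩
    exact ⟨hA, List.length_ofFn⟩

theorem finite_setOf_length {S : Set (List (Finset ℕ))} {n : ℕ} (hS : S ⊆ runLists n) (t : ℕ) :
    {L ∈ S | L.length = t}.Finite := by
  rw [setOf_length_eq_image]
  exact ((finite_runTuples t n).subset fun A hA => ofFn_mem_runLists_iff.1 (hS hA)).image _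

theorem length_le_of_mem_runLists {n : ℕ} {L : List (Finset ℕ)} (h : L ∈ runLists n) :
    L.length ≤ n := by
  by_contra! hlt
  rw [← List.ofFn_get L, ofFn_mem_runLists_iff, runTuples_of_lt hlt] at h
  exact h

theorem finite_runLists (n : ℕ) : (runLists n).Finite := by
  refine ((Set.finite_Iic n).biUnion fun t _ =>
    finite_setOf_length (subset_refl (runLists n)) t).subset ?_
  exact fun L hL => Set.mem_biUnion (x := L.length) (length_le_of_mem_runLists hL) ⟨hL, rfl⟩

theorem ncard_eq_sum_length {S : Set (List (Finset ℕ))} {n : ℕ} (hS : S ⊆ runLists n) :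
    S.ncard = ∑ t ∈ Finset.range (n + 1), {A : Fin t → Finset ℕ | List.ofFn A ∈ S}.ncard := by
  have hfin : S.Finite := (finite_runLists n).subset hS
  rw [Set.ncard_eq_toFinset_card S hfin, Finset.card_eq_sum_card_fiberwise
    (f := List.length) (t := Finset.range (n + 1))]
  · refine Finset.sum_congr rfl fun t _ => ?_
    rw [← (List.ofFn_injective.injOn).ncard_image, ← setOf_length_eq_image,
      ← Set.ncard_coe_finset]
    congr 1
    ext L
    simp
  · intro L hL
    have := length_le_of_mem_runLists (hS (by simpa using hL))
    simpa using Nat.lt_succ_of_le this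

theorem ncard_runLists (n : ℕ) :
    (runLists n).ncard = ∑ t ∈ Finset.range (n + 1), tupleCount t n := by
  rw [ncard_eq_sum_length subset_rfl]
  simp only [ofFn_mem_runLists_iff, Set.ofPred_mem_eq, tupleCount]

theorem ncard_leadingLists (n : ℕ) :
    ((leadingLists n).ncard : ℝ) =
      ∑ t ∈ Finset.range (n + 1), (t : ℝ)⁻¹ * tupleCount t n := by
  rw [ncard_eq_sum_length (S := leadingLists n) fun L hL => hL.1, Nat.cast_sum]
  refine Finset.sum_congr rfl fun t _ => ?_
  rcases t with _ | t
  -- The empty list has no leading run, matching the convention `0⁻¹ = 0`.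
  · have : {A : Fin 0 → Finset ℕ | List.ofFn A ∈ leadingLists n} = ∅ := by
      rw [Set.eq_empty_iff_forall_notMem]
      rintro A ⟨-, B, L, h, -⟩
      simp at h
    rw [this]
    simp
  · simp only [ofFn_mem_leadingLists_iff, Set.ofPred_mem_eq]
    rw [← succ_mul_ncard_leadingTuples, Nat.cast_mul, inv_mul_cancel_left₀]
    positivity

theorem finite_biUnion_runLists (n : ℕ) : (⋃ k ∈ Set.Iio n, runLists k).Finite :=
  (Set.finite_Iio n).biUnion fun k _ => finite_runLists k

theorem strictMultiplexCount_eq (n : ℕ) :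
    strictMultiplexCount n = (⋃ k ∈ Set.Iio n, runLists k).ncard :=
  let ⟨f⟩ := nonempty_strictMultiplexPrimePatterns_equiv n
  Set.ncard_congr' f

theorem finite_strictMultiplexPrimePatterns (n : ℕ) :
    (strictMultiplexPrimePatterns n).Finite := by
  obtain ⟨f⟩ := nonempty_strictMultiplexPrimePatterns_equiv n
  have := (finite_biUnion_runLists n).to_subtype
  exact Finite.of_equiv _ f.symm

theorem ncard_normalPrimePatterns_eq {n : ℕ} (hn : 0 < n) :
    (normalPrimePatterns 2 n).ncard = (leadingLists n).ncard :=
  let ⟨f⟩ := nonempty_normalPrimePatterns_equiv hn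
  Set.ncard_congr' f

theorem finite_normalPrimePatterns {n : ℕ} (hn : 0 < n) : (normalPrimePatterns 2 n).Finite := by
  obtain ⟨f⟩ := nonempty_normalPrimePatterns_equiv hn
  have := ((finite_runLists n).subset fun L (hL : L ∈ leadingLists n) => hL.1).to_subtype
  exact Finite.of_equiv _ f.symm

/-- Raising the period by one admits exactly the lists of weight `n`. -/
theorem strictMultiplexCount_succ (n : ℕ) :
    strictMultiplexCount (n + 1) = strictMultiplexCount n + (runLists n).ncard := by
  rw [strictMultiplexCount_eq, strictMultiplexCount_eq, add_comm _ (runLists n).ncard]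
  have : Set.Iio (n + 1) = insert n (Set.Iio n) := by
    ext k
    simp
  rw [this, Set.biUnion_insert, Set.ncard_union_eq _ (finite_runLists n)
    (finite_biUnion_runLists n)]
  rw [Set.disjoint_left]
  intro L hL hL'
  simp only [Set.mem_iUnion] at hL'
  obtain ⟨k, hk, hk'⟩ := hL'
  rw [← hk'.2.2, hL.2.2] at hk
  simp at hk

theorem multiplexCount_eq {n : ℕ} (hn : 0 < n) :
    multiplexCount n = strictMultiplexCount n + (leadingLists n).ncard := by
  rw [multiplexCount, strictMultiplexCount, ← ncard_normalPrimePatterns_eq hn,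
    ← Set.ncard_union_eq (s := strictMultiplexPrimePatterns n) Set.disjoint_sdiff_left
      (finite_strictMultiplexPrimePatterns n) (finite_normalPrimePatterns hn),
    strictMultiplexPrimePatterns, Set.sdiff_union_of_subset (normalPrimePatterns_subset n)]

/-! ### Asymptotics and the two series -/

theorem tendsto_strictMultiplexCount :
    Tendsto (fun n => (strictMultiplexCount n : ℝ) / 2 ^ n) atTop (𝓝 (∑' t, tupleDensity t)) := by
  refine tendsto_div_two_pow_of_succ (p := fun n => ((runLists n).ncard : ℝ)) (fun n => ?_) ?_
  · rw [strictMultiplexCount_succ]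
    push_cast
    rfl
  · have := tendsto_tsum_tupleRatio (f := fun _ => 1) (fun _ => zero_le_one) fun _ => le_rfl
    simp only [← sum_range_div_two_pow_eq_tsum] at this
    simpa only [ncard_runLists, Nat.cast_sum, one_mul] using this

theorem tendsto_ncard_leadingLists :
    Tendsto (fun n => ((leadingLists n).ncard : ℝ) / 2 ^ n) atTop
      (𝓝 (∑' t : ℕ, (t : ℝ)⁻¹ * tupleDensity t)) := by
  have := tendsto_tsum_tupleRatio (f := fun t => (t : ℝ)⁻¹) (fun t => by positivity)
    fun t => Nat.cast_inv_le_one t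
  simp only [← sum_range_div_two_pow_eq_tsum] at this
  simpa only [ncard_leadingLists] using this

theorem isEquivalent_mul_two_pow {s : ℕ → ℝ} {c : ℝ} (hc : c ≠ 0)
    (h : Tendsto (fun n => s n / 2 ^ n) atTop (𝓝 c)) :
    Asymptotics.IsEquivalent atTop s fun n => c * 2 ^ n := by
  rw [Asymptotics.isEquivalent_iff_tendsto_one
    (Eventually.of_forall fun n => mul_ne_zero hc (pow_ne_zero n two_ne_zero))]
  have := h.div_const c
  rw [div_self hc] at this
  refine this.congr fun n => ?_
  rw [Pi.div_apply, div_div, mul_comm c]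

theorem summable_inv_mul_tupleDensity : Summable fun t : ℕ => (t : ℝ)⁻¹ * tupleDensity t :=
  summable_tupleDensity.of_nonneg_of_le
    (fun t => mul_nonneg (by positivity) (tupleDensity_nonneg t))
    fun t => mul_le_of_le_one_left (tupleDensity_nonneg t) (Nat.cast_inv_le_one t)

theorem hasSum_pnat {f : ℕ → ℝ} (hf : Summable f) (h0 : f 0 = 0) :
    HasSum (fun t : ℕ+ => f t) (∑' t, f t) := by
  rw [hf.tsum_eq_zero_add, h0, zero_add, ← tsum_pnat_eq_tsum_succ (f := f)]
  exact (summable_pnat_iff_summable_succ.2 ((summable_nat_add_iff 1).2 hf)).hasSum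

theorem hasSum_mul_q : HasSum (fun t : ℕ+ => ((t : ℕ) : ℝ) * q t) (∑' t, tupleDensity t) :=
  hasSum_pnat summable_tupleDensity (by simp [tupleDensity])

theorem hasSum_q : HasSum q (∑' t : ℕ, (t : ℝ)⁻¹ * tupleDensity t) := by
  convert hasSum_pnat summable_inv_mul_tupleDensity (by simp) using 2 with t
  rw [tupleDensity, inv_mul_cancel_left₀ (by exact_mod_cast t.ne_zero), q_eq_qNat]

theorem q_pos (t : ℕ+) : 0 < q t := by
  rw [q_eq_qNat, ← Nat.succ_pred_eq_of_pos t.pos]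
  exact qNat_pos _

end Juggling

end

theorem mainTheorem7 :
    (Summable fun t : ℕ+ => (((t : ℕ) : ℝ) + 1) * Juggling.q t) ∧
    Asymptotics.IsEquivalent Filter.atTop
      (fun n : ℕ => (Juggling.multiplexCount n : ℝ))
      (fun n : ℕ => (∑' t : ℕ+, (((t : ℕ) : ℝ) + 1) * Juggling.q t) * 2 ^ n) ∧
    (Summable fun t : ℕ+ => ((t : ℕ) : ℝ) * Juggling.q t) ∧
    Asymptotics.IsEquivalent Filter.atTop
      (fun n : ℕ => (Juggling.strictMultiplexCount n : ℝ))
      (fun n : ℕ => (∑' t : ℕ+, ((t : ℕ) : ℝ) * Juggling.q t) * 2 ^ n) := by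
  have h1 := Juggling.hasSum_mul_q
  have h2 : HasSum (fun t : ℕ+ => (((t : ℕ) : ℝ) + 1) * Juggling.q t) _ :=
    (h1.add Juggling.hasSum_q).congr_fun fun t => by ring
  have hpos : 0 < ∑' t : ℕ+, ((t : ℕ) : ℝ) * Juggling.q t :=
    h1.summable.tsum_pos (fun t => mul_nonneg (Nat.cast_nonneg _) (Juggling.q_pos t).le) 1
      (mul_pos (by simp) (Juggling.q_pos 1))
  have hpos' : 0 < ∑' t : ℕ+, (((t : ℕ) : ℝ) + 1) * Juggling.q t :=
    h2.summable.tsum_pos (fun t => mul_nonneg (by positivity) (Juggling.q_pos t).le) 1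
      (mul_pos (by positivity) (Juggling.q_pos 1))
  refine ⟨h2.summable, Juggling.isEquivalent_mul_two_pow hpos'.ne' ?_, h1.summable,
    Juggling.isEquivalent_mul_two_pow hpos.ne' ?_⟩
  · rw [h2.tsum_eq]
    refine (Juggling.tendsto_strictMultiplexCount.add
      Juggling.tendsto_ncard_leadingLists).congr' ?_
    filter_upwards [Filter.eventually_gt_atTop 0] with n hn
    rw [Juggling.multiplexCount_eq hn, Nat.cast_add, add_div]
  · rw [h1.tsum_eq]
    exact Juggling.tendsto_strictMultiplexCount
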